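/- **Theorem (Polytime AMAPF).** Consider the following anonymous multi-agent path finding problem. An instance consists of an undirected graph $G=(V,E)$ with $n=|V|$ nodes, edge weights $w\colon E\to\mathbb{N}$ (travel times), $k$ agents with pairwise distinct start nodes $s_1,\dots,s_k\in V$, and $k$ pairwise distinct goal nodes $g_1,\dots,g_k\in V$. In each action an agent either waits at its node, which takes one time unit, or travels along an edge $\{u,v\}\in E$, which takes $w(u,v)$ time units; a *route* is a finite sequence of such actions, executed one after the other from time $0$, and after its last action the agent stays at its last node forever. A *routing* consists of routes $\pi_1,\dots,\pi_k$ such that $\pi_i$ starts in $s_i$ and ends in $g_{\sigma(i)}$, for some permutation $\sigma$ of $\{1,\dots,k\}$ that the solver chooses. It is *collision-free* if no two agents are located at the same node at the same time (node conflict) and no two agents travel along the same edge, in whichever directions, at the same time (edge conflict). There is a single program of a unit-cost random access machine (with addition and truncated subtraction as arithmetic operations, and with adjacency matrix, weight matrix, start nodes and goals given in memory) such that for every polynomial $p$ there is a polynomial $q$ with the following property. On every instance whose edge weights are at most $p(n+k)$, the program halts after at most $q(n+k)$ steps, and it either outputs the complete routes of a collision-free routing, or reports that there is no solution, the latter only if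 the instance has no routing at all, not even one with collisions. No optimality of the routing with respect to sum-of-cost or makespan is claimed. -/

import Mathlib

/-! ### The machine model: unit-cost random access machine, programmed by while programs

A machine has registers and finitely many arrays (random access memories), all holding natural
numbers, and a write-only output stream. The arithmetic operations are addition and truncated
subtraction; there is no multiplication, so that unit-cost time is polynomially related to the
time of a multitape Turing machine. -/

namespace RAM

/-- Arithmetic expressions over registers and array cells. -/
inductive Expr where
  /-- a constant -/
  | lit (c : ℕ) : Expr
  /-- the content of a register -/
  | reg (x : ℕ) : Expr
  /-- the cell of array `a` whose index is the value of `e` -/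
  | cell (a : ℕ) (e : Expr) : Expr
  /-- sum -/
  | plus (e₁ e₂ : Expr) : Expr
  /-- truncated difference -/
  | minus (e₁ e₂ : Expr) : Expr

/-- Programs. A program mentions only finitely many registers and arrays. -/
inductive Prog where
  /-- do nothing -/
  | skip : Prog
  /-- register `x` := `e` -/
  | assign (x : ℕ) (e : Expr) : Prog
  /-- cell `i` of array `a` := `e` -/
  | store (a : ℕ) (i e : Expr) : Prog
  /-- append the value of `e` to the output stream -/
  | emit (e : Expr) : Prog
  /-- sequential composition -/
  | seq (c₁ c₂ : Prog) : Prog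
  /-- run `c₁` if the value of `e` is nonzero, otherwise run `c₂` -/
  | ite (e : Expr) (c₁ c₂ : Prog) : Prog
  /-- repeat `c` as long as the value of `e` is nonzero -/
  | loop (e : Expr) (c : Prog) : Prog

/-- A state of the machine. -/
structure State where
  /-- content of the registers -/
  reg : ℕ → ℕ
  /-- content of the arrays: `arr a i` is cell `i` of array `a` -/
  arr : ℕ → ℕ → ℕ
  /-- the numbers written to the output stream so far -/
  out : List ℕ

/-- The value of an expression in a state. -/
def Expr.eval (s : State) : Expr → ℕ
  | .lit c => c
  | .reg x => s.reg x
  | .cell a e => s.arr a (e.eval s)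
  | .plus e₁ e₂ => e₁.eval s + e₂.eval s
  | .minus e₁ e₂ => e₁.eval s - e₂.eval s

/-- The time for evaluating an expression: one unit for each operation, register access,
constant and memory access in it. -/
def Expr.cost : Expr → ℕ
  | .lit _ => 1
  | .reg _ => 1
  | .cell _ e => e.cost + 1
  | .plus e₁ e₂ => e₁.cost + e₂.cost + 1
  | .minus e₁ e₂ => e₁.cost + e₂.cost + 1

/-- `Exec c s t s'`: started in state `s`, the program `c` halts in state `s'` after exactly
`t` time units. Every executed assignment, write, output and test costs one unit plus the time
for evaluating its expressions. -/
inductive Exec : Prog → State → ℕ → State → Prop where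
  | skip (s : State) : Exec .skip s 1 s
  | assign (x : ℕ) (e : Expr) (s : State) :
      Exec (.assign x e) s (e.cost + 1)
        { s with reg := Function.update s.reg x (e.eval s) }
  | store (a : ℕ) (i e : Expr) (s : State) :
      Exec (.store a i e) s (i.cost + e.cost + 1)
        { s with
          arr := Function.update s.arr a (Function.update (s.arr a) (i.eval s) (e.eval s)) }
  | emit (e : Expr) (s : State) :
      Exec (.emit e) s (e.cost + 1) { s with out := s.out ++ [e.eval s] }
  | seq {c₁ c₂ : Prog} {s s' s'' : State} {t₁ t₂ : ℕ} :
      Exec c₁ s t₁ s' → Exec c₂ s' t₂ s'' → Exec (.seq c₁ c₂) s (t₁ + t₂) s''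
  | ite_true {e : Expr} {c₁ c₂ : Prog} {s s' : State} {t : ℕ} :
      e.eval s ≠ 0 → Exec c₁ s t s' → Exec (.ite e c₁ c₂) s (e.cost + 1 + t) s'
  | ite_false {e : Expr} {c₁ c₂ : Prog} {s s' : State} {t : ℕ} :
      e.eval s = 0 → Exec c₂ s t s' → Exec (.ite e c₁ c₂) s (e.cost + 1 + t) s'
  | loop_true {e : Expr} {c : Prog} {s s' s'' : State} {t₁ t₂ : ℕ} :
      e.eval s ≠ 0 → Exec c s t₁ s' → Exec (.loop e c) s' t₂ s'' →
        Exec (.loop e c) s (e.cost + 1 + t₁ + t₂) s''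
  | loop_false {e : Expr} {c : Prog} {s : State} :
      e.eval s = 0 → Exec (.loop e c) s (e.cost + 1) s

end RAM

/-! ### Discrete anonymous multi-agent path finding -/

/-- An instance: an undirected graph on `n` nodes with edge weights in `ℕ` (the travel times), and
`k` agents with distinct start nodes together with `k` distinct goal nodes. Only the weights of
edges matter. -/
structure AMAPF where
  /-- number of nodes -/
  n : ℕ
  /-- number of agents, and of goals -/
  k : ℕ
  /-- the graph -/
  graph : SimpleGraph (Fin n)
  /-- the edge weights -/
  weight : Fin n → Fin n → ℕ
  /-- the weights are symmetric -/
  weight_symm : ∀ u v, graph.Adj u v → weight u v = weight v u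
  /-- the start nodes of the agents -/
  start : Fin k ↪ Fin n
  /-- the goals -/
  goal : Fin k ↪ Fin n

/-- A node sequence `node 0, …, node len`. (The values of `node` after `len` are irrelevant.) -/
structure Route (n : ℕ) where
  /-- number of actions -/
  len : ℕ
  /-- the nodes in the order in which they are visited -/
  node : ℕ → Fin n

namespace AMAPF

variable (I : AMAPF)

/-- The duration of the action that leads from `u` to `v`: waiting at a node takes one time unit,
travelling along an edge takes its weight. -/
def duration (u v : Fin I.n) : ℕ := if u = v then 1 else I.weight u v

/-- The time at which the route reaches its `j`-th node. -/
def arrival (ρ : Route I.n) (j : ℕ) : ℕ :=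
  ∑ i ∈ Finset.range j, I.duration (ρ.node i) (ρ.node (i + 1))

/-- Every action of the route waits at a node or travels along an edge of the graph. -/
def IsWalk (ρ : Route I.n) : Prop :=
  ∀ j < ρ.len, ρ.node j = ρ.node (j + 1) ∨ I.graph.Adj (ρ.node j) (ρ.node (j + 1))

/-- The agent that follows the route `ρ` is located at node `v` at time `t`. At the end of its
route it stays at the last node forever. -/
def LocatedAt (ρ : Route I.n) (v : Fin I.n) (t : ℕ) : Prop :=
  ∃ j ≤ ρ.len, ρ.node j = v ∧ (I.arrival ρ j = t ∨ (j = ρ.len ∧ I.arrival ρ j ≤ t))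

/-- The agent that follows the route `ρ` is travelling along an edge from `u` to `v` during the
time step from `t` to `t + 1`. -/
def Traverses (ρ : Route I.n) (u v : Fin I.n) (t : ℕ) : Prop :=
  ∃ j < ρ.len, ρ.node j = u ∧ ρ.node (j + 1) = v ∧ u ≠ v ∧
    I.arrival ρ j ≤ t ∧ t < I.arrival ρ (j + 1)

/-- Two agents are at the same node at the same time. -/
def NodeConflict (ρ ρ' : Route I.n) : Prop :=
  ∃ v t, I.LocatedAt ρ v t ∧ I.LocatedAt ρ' v t

/-- Two agents are on the same edge, in the same or in opposite directions, at the same time. -/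
def EdgeConflict (ρ ρ' : Route I.n) : Prop :=
  ∃ u v t, I.Traverses ρ u v t ∧ (I.Traverses ρ' u v t ∨ I.Traverses ρ' v u t)

/-- Each agent walks from its start node to a goal, where the goals are assigned to the agents by
some bijection. -/
def IsRouting (π : Fin I.k → Route I.n) : Prop :=
  (∀ i, I.IsWalk (π i) ∧ (π i).node 0 = I.start i) ∧
    ∃ σ : Equiv.Perm (Fin I.k), ∀ i, (π i).node (π i).len = I.goal (σ i)

/-- No two different agents have a node conflict or an edge conflict. -/
def CollisionFree (π : Fin I.k → Route I.n) : Prop :=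
  ∀ i j, i ≠ j → ¬ I.NodeConflict (π i) (π j) ∧ ¬ I.EdgeConflict (π i) (π j)

/-- The array that holds the entries of a list of length `k`, and 0 elsewhere. -/
def vectorArray {k : ℕ} (v : Fin k → ℕ) (i : ℕ) : ℕ :=
  if h : i < k then v ⟨i, h⟩ else 0

/-- The array that holds the entries of an `n × n` matrix row by row (entry `(u, v)` in cell
`u * n + v`), and 0 elsewhere. -/
def matrixArray {n : ℕ} (M : Fin n → Fin n → ℕ) : ℕ → ℕ :=
  vectorArray (k := n * n) fun i => M i.divNat i.modNat

open Classical in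
/-- The initial state of the machine on an instance: `n` and `k` are in registers 0 and 1; arrays
0 and 1 hold the adjacency matrix and the matrix of the edge weights (0 for pairs that are not
edges); arrays 2 and 3 hold the start nodes and the goals; everything else is 0. -/
noncomputable def input : RAM.State where
  reg := fun x => match x with
    | 0 => I.n
    | 1 => I.k
    | _ => 0
  arr := fun a => match a with
    | 0 => matrixArray fun u v => if I.graph.Adj u v then 1 else 0
    | 1 => matrixArray fun u v => if I.graph.Adj u v then I.weight u v else 0
    | 2 => vectorArray fun i => (I.start i : ℕ)
    | 3 => vectorArray fun i => (I.goal i : ℕ)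
    | _ => fun _ => 0
  out := []

/-- A route is written as the list of its nodes, node `v` as the number `v + 1`, and the
terminator 0. -/
def encodeRoute (ρ : Route I.n) : List ℕ :=
  (List.range (ρ.len + 1)).map (fun j => (ρ.node j : ℕ) + 1) ++ [0]

/-- The answer `none` ("there is no solution") is written as 0, the answer `some π` as 1 followed
by the complete routes of the agents, one after the other. -/
def encodeAnswer : Option (Fin I.k → Route I.n) → List ℕ
  | none => [0]
  | some π => 1 :: (List.finRange I.k).flatMap (fun i => I.encodeRoute (π i))

/-- An answer is correct if it is a collision-free routing, or if it reports that there is no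
solution and indeed no routing exists, not even one with collisions. -/
def IsCorrectAnswer : Option (Fin I.k → Route I.n) → Prop
  | none => ¬ ∃ π, I.IsRouting π
  | some π => I.IsRouting π ∧ I.CollisionFree π

end AMAPF

/-! Grow a spanning forest whose trees span the connected components, and let `flow` at `x` be the
number of starts minus the number of goals in the subtree of `x`. This is the net number of agents
to be sent over the edge from `x` to its parent. A route never leaves its component, so any routing
forces every component to contain as many starts as goals. Then the flow vanishes at all roots
(`RankedForest.root_eq_zero`), and a root with nonzero flow justifies the answer "no solution".

Otherwise, move an agent over a forest edge whenever the flow asks for it and the target is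
unoccupied. This lowers the sum of the absolute flows by one, and that sum is at most n² initially
(`RankedForest.subtreeSum_le_card`), so at most n² moves are made. If no move is possible, flow
conservation over the occupied set shows that exactly the goals are occupied
(`RankedForest.eq_of_stuck`). Since agents are interchangeable, it is irrelevant which of them sits
on which goal.

The moves are made one at a time while all other agents wait, so no two agents ever travel
simultaneously. One additional unit of waiting after each move takes care of edges of weight zero
(`Synchronous.step`). The waits are written out one by one, which is where the polynomial bound on
the weights is needed.

For the machine, `Runs` combines termination, running time and a postcondition. The time is measured
by a bound `B` on the iterations of every single loop, and for a fixed program it is a polynomial in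
`B` (`Prog.exists_time_eq_eval`). `Frame` supplies everything that a program cannot change for
syntactic reasons. -/

namespace RAM

/-! ### What a program leaves unchanged -/

/-- The program assigns to register `x`. -/
def Prog.wreg : Prog → ℕ → Bool
  | .assign y _, x => y == x
  | .seq c d, x => c.wreg x || d.wreg x
  | .ite _ c d, x => c.wreg x || d.wreg x
  | .loop _ c, x => c.wreg x
  | _, _ => false

/-- The program writes to array `a`. -/
def Prog.warr : Prog → ℕ → Bool
  | .store b _ _, a => b == a
  | .seq c d, a => c.warr a || d.warr a
  | .ite _ c d, a => c.warr a || d.warr a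
  | .loop _ c, a => c.warr a
  | _, _ => false

/-- The program writes to the output stream. -/
def Prog.emits : Prog → Bool
  | .emit _ => true
  | .seq c d => c.emits || d.emits
  | .ite _ c d => c.emits || d.emits
  | .loop _ c => c.emits
  | _ => false

/-- The states `s` and `s'` agree on everything that `c` cannot change. -/
structure Frame (c : Prog) (s s' : State) : Prop where
  reg : ∀ x, c.wreg x = false → s'.reg x = s.reg x
  arr : ∀ a, c.warr a = false → s'.arr a = s.arr a
  out : c.emits = false → s'.out = s.out

theorem Exec.frame {c : Prog} {s s' : State} {t : ℕ} (h : Exec c s t s') : Frame c s s' := by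
  induction h with
  | skip s => exact ⟨fun _ _ => rfl, fun _ _ => rfl, fun _ => rfl⟩
  | assign x e s =>
    refine ⟨fun y hy => ?_, fun _ _ => rfl, fun _ => rfl⟩
    simp only [Prog.wreg, beq_eq_false_iff_ne] at hy
    exact Function.update_of_ne (Ne.symm hy) _ _
  | store a i e s =>
    refine ⟨fun _ _ => rfl, fun b hb => ?_, fun _ => rfl⟩
    simp only [Prog.warr, beq_eq_false_iff_ne] at hb
    exact Function.update_of_ne (Ne.symm hb) _ _
  | emit e s => exact ⟨fun _ _ => rfl, fun _ _ => rfl, fun h => by simp [Prog.emits] at h⟩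
  | seq _ _ h₁ h₂ =>
    refine ⟨fun x hx => ?_, fun a ha => ?_, fun ho => ?_⟩
    · simp only [Prog.wreg, Bool.or_eq_false_iff] at hx
      rw [h₂.reg x hx.2, h₁.reg x hx.1]
    · simp only [Prog.warr, Bool.or_eq_false_iff] at ha
      rw [h₂.arr a ha.2, h₁.arr a ha.1]
    · simp only [Prog.emits, Bool.or_eq_false_iff] at ho
      rw [h₂.out ho.2, h₁.out ho.1]
  | ite_true _ _ h =>
    refine ⟨fun x hx => ?_, fun a ha => ?_, fun ho => ?_⟩
    · simp only [Prog.wreg, Bool.or_eq_false_iff] at hx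
      exact h.reg x hx.1
    · simp only [Prog.warr, Bool.or_eq_false_iff] at ha
      exact h.arr a ha.1
    · simp only [Prog.emits, Bool.or_eq_false_iff] at ho
      exact h.out ho.1
  | ite_false _ _ h =>
    refine ⟨fun x hx => ?_, fun a ha => ?_, fun ho => ?_⟩
    · simp only [Prog.wreg, Bool.or_eq_false_iff] at hx
      exact h.reg x hx.2
    · simp only [Prog.warr, Bool.or_eq_false_iff] at ha
      exact h.arr a ha.2
    · simp only [Prog.emits, Bool.or_eq_false_iff] at ho
      exact h.out ho.2
  | loop_true _ _ _ h₁ h₂ =>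
    refine ⟨fun x hx => ?_, fun a ha => ?_, fun ho => ?_⟩
    · rw [h₂.reg x hx, h₁.reg x hx]
    · rw [h₂.arr a ha, h₁.arr a ha]
    · rw [h₂.out ho, h₁.out ho]
  | loop_false _ => exact ⟨fun _ _ => rfl, fun _ _ => rfl, fun _ => rfl⟩

/-! ### Running time and rules for total correctness -/

/-- The running time of a program in which every loop makes at most `B` iterations. -/
def Prog.time (B : ℕ) : Prog → ℕ
  | .skip => 1
  | .assign _ e => e.cost + 1
  | .store _ i e => i.cost + e.cost + 1
  | .emit e => e.cost + 1
  | .seq c d => c.time B + d.time B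
  | .ite e c d => e.cost + 1 + (c.time B + d.time B)
  | .loop e c => (B + 1) * (e.cost + 1 + c.time B)

/-- The program is fixed, so its nesting depth is a constant: each loop contributes one factor `B +
1`. -/
theorem Prog.exists_time_eq_eval (c : Prog) :
    ∃ P : Polynomial ℕ, ∀ B, c.time B = P.eval B := by
  induction c with
  | skip => exact ⟨1, fun B => by simp [Prog.time]⟩
  | assign x e => exact ⟨.C (e.cost + 1), fun B => by rw [Polynomial.eval_C, Prog.time]⟩
  | store a i e => exact ⟨.C (i.cost + e.cost + 1), fun B => by rw [Polynomial.eval_C, Prog.time]⟩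
  | emit e => exact ⟨.C (e.cost + 1), fun B => by rw [Polynomial.eval_C, Prog.time]⟩
  | seq c d hc hd =>
    obtain ⟨P, hP⟩ := hc
    obtain ⟨Q, hQ⟩ := hd
    exact ⟨P + Q, fun B => by rw [Polynomial.eval_add, Prog.time, hP, hQ]⟩
  | ite e c d hc hd =>
    obtain ⟨P, hP⟩ := hc
    obtain ⟨Q, hQ⟩ := hd
    exact ⟨.C (e.cost + 1) + (P + Q), fun B => by
      rw [Polynomial.eval_add, Polynomial.eval_add, Polynomial.eval_C, Prog.time, hP, hQ]⟩
  | loop e c hc =>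
    obtain ⟨P, hP⟩ := hc
    exact ⟨(.X + 1) * (.C (e.cost + 1) + P), fun B => by
      rw [Polynomial.eval_mul, Polynomial.eval_add, Polynomial.eval_add, Polynomial.eval_C,
        Polynomial.eval_X, Polynomial.eval_one, Prog.time, hP]⟩

/-- Started in `s`, the program `c` halts within the time `c.time B`, in a state that satisfies
`Q`. -/
def Runs (B : ℕ) (c : Prog) (s : State) (Q : State → Prop) : Prop :=
  ∃ t s', Exec c s t s' ∧ t ≤ c.time B ∧ Q s'

variable {B : ℕ} {c d : Prog} {s : State} {e : Expr} {Q R : State → Prop}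

theorem Runs.seq (hc : Runs B c s R) (hd : ∀ s', Frame c s s' → R s' → Runs B d s' Q) :
    Runs B (.seq c d) s Q := by
  obtain ⟨t, s', h, ht, hR⟩ := hc
  obtain ⟨u, s'', h', hu, hQ⟩ := hd s' h.frame hR
  exact ⟨t + u, s'', .seq h h', Nat.add_le_add ht hu, hQ⟩

theorem Runs.mono (hc : Runs B c s R) (h : ∀ s', Frame c s s' → R s' → Q s') : Runs B c s Q := by
  obtain ⟨t, s', h', ht, hR⟩ := hc
  exact ⟨t, s', h', ht, h s' h'.frame hR⟩

theorem Runs.ite (hc : e.eval s ≠ 0 → Runs B c s Q) (hd : e.eval s = 0 → Runs B d s Q) :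
    Runs B (.ite e c d) s Q := by
  by_cases he : e.eval s = 0
  · obtain ⟨t, s', h, ht, hQ⟩ := hd he
    refine ⟨_, s', .ite_false he h, ?_, hQ⟩
    simp only [Prog.time]
    lia
  · obtain ⟨t, s', h, ht, hQ⟩ := hc he
    refine ⟨_, s', .ite_true he h, ?_, hQ⟩
    simp only [Prog.time]
    lia

/-- The program contains no loops. -/
def Prog.straight : Prog → Bool
  | .seq c d => c.straight && d.straight
  | .ite _ c d => c.straight && d.straight
  | .loop _ _ => false
  | _ => true

/-- The effect of a program without loops. -/
def Prog.run : Prog → State → State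
  | .assign x e, s => { s with reg := Function.update s.reg x (e.eval s) }
  | .store a i e, s =>
    { s with arr := Function.update s.arr a (Function.update (s.arr a) (i.eval s) (e.eval s)) }
  | .emit e, s => { s with out := s.out ++ [e.eval s] }
  | .seq c d, s => d.run (c.run s)
  | .ite e c d, s => if e.eval s = 0 then d.run s else c.run s
  | _, s => s

/-- Reduces loop-free code to computing `Prog.run`. The catch-all case of `Prog.run` is wrong for
loops, which `hc` excludes. -/
theorem Runs.straight (hc : c.straight = true) (hQ : Q (c.run s)) : Runs B c s Q := by
  induction c generalizing s Q with
  | skip => exact ⟨_, _, .skip s, le_rfl, hQ⟩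
  | assign x e => exact ⟨_, _, .assign x e s, le_rfl, hQ⟩
  | store a i e => exact ⟨_, _, .store a i e s, le_rfl, hQ⟩
  | emit e => exact ⟨_, _, .emit e s, le_rfl, hQ⟩
  | seq c d ihc ihd =>
    simp only [Prog.straight, Bool.and_eq_true] at hc
    exact Runs.seq (ihc (Q := fun s' => Q (d.run s')) hc.1 hQ) fun s' _ h => ihd hc.2 h
  | ite e c d ihc ihd =>
    simp only [Prog.straight, Bool.and_eq_true] at hc
    simp only [Prog.run] at hQ
    exact Runs.ite (fun he => ihc hc.1 (by rwa [if_neg he] at hQ))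
      fun he => ihd hc.2 (by rwa [if_pos he] at hQ)
  | loop e c => simp [Prog.straight] at hc

/-- `for i := 0, …, e - 1 do c` -/
def forLoop (i : ℕ) (e : Expr) (c : Prog) : Prog :=
  .seq (.assign i (.lit 0))
    (.loop (.minus e (.reg i)) (.seq c (.assign i (.plus (.reg i) (.lit 1)))))

/-- The state `s` with the value `v` in register `x`. -/
def State.setReg (s : State) (x v : ℕ) : State := { s with reg := Function.update s.reg x v }

theorem Frame.trans {s' s'' : State} (h : Frame c s s') (h' : Frame c s' s'') : Frame c s s'' :=
  ⟨fun x hx => (h'.reg x hx).trans (h.reg x hx), fun a ha => (h'.arr a ha).trans (h.arr a ha),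
    fun ho => (h'.out ho).trans (h.out ho)⟩

/-- The invariant has to mention only what the loop changes; everything else is recovered from the
frame relative to the initial state. `Inv j` refers to the state in which the counter has already
been set to `j`, hence the `setReg` in `h0` and `hstep`. -/
theorem Runs.forLoop {i : ℕ} (N : ℕ) (Inv : ℕ → State → Prop) (hi : c.wreg i = false)
    (hB : N ≤ B) (he : ∀ s', Frame (forLoop i e c) s s' → e.eval s' = N)
    (h0 : Inv 0 (s.setReg i 0))
    (hstep : ∀ j s', j < N → Frame (RAM.forLoop i e c) s s' → s'.reg i = j → Inv j s' →
      Runs B c s' fun s'' => Inv (j + 1) (s''.setReg i (j + 1)))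
    (hQ : ∀ s', Frame (RAM.forLoop i e c) s s' → Inv N s' → Q s') :
    Runs B (RAM.forLoop i e c) s Q := by
  have hset : Frame (RAM.forLoop i e c) s (s.setReg i 0) := by
    refine ⟨fun x hx => ?_, fun _ _ => rfl, fun _ => rfl⟩
    have : i ≠ x := by
      rintro rfl
      simp [RAM.forLoop, Prog.wreg] at hx
    exact Function.update_of_ne this.symm _ _
  -- Induction on the number `m` of remaining iterations; the factor `m + 1` also counts the final
  -- failing test.
  have main : ∀ m j s', m + j = N → Frame (RAM.forLoop i e c) s s' → s'.reg i = j → Inv j s' →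
      ∃ t s'', Exec (.loop (.minus e (.reg i)) (.seq c (.assign i (.plus (.reg i) (.lit 1))))) s' t s''
        ∧ t ≤ (m + 1) * ((Expr.minus e (.reg i)).cost + 1 +
          (Prog.seq c (.assign i (.plus (.reg i) (.lit 1)))).time B) ∧ Inv N s'' := by
    intro m
    induction m with
    | zero =>
      intro j s' hj hf hr hinv
      refine ⟨_, s', .loop_false ?_, ?_, ?_⟩
      · simp only [Expr.eval, he s' hf, hr]
        lia
      · lia
      · obtain rfl : j = N := by lia
        exact hinv
    | succ m ih =>
      intro j s' hj hf hr hinv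
      obtain ⟨t, s₁, hx, ht, hinv'⟩ := hstep j s' (by lia) hf hr hinv
      have hr₁ : s₁.reg i = j := by rw [hx.frame.reg i hi, hr]
      -- Incrementing the counter costs 4 units.
      have hx' : Exec (.seq c (.assign i (.plus (.reg i) (.lit 1)))) s' (t + 4)
          (s₁.setReg i (j + 1)) := by
        have := Exec.assign i (.plus (.reg i) (.lit 1)) s₁
        simp only [Expr.eval, Expr.cost, hr₁] at this
        exact .seq hx this
      have hf' : Frame (RAM.forLoop i e c) s (s₁.setReg i (j + 1)) := by
        have h := hx'.frame
        refine hf.trans ⟨fun x hxx => h.reg x ?_, fun a ha => h.arr a ?_, fun ho => h.out ?_⟩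
        · simpa [RAM.forLoop, Prog.wreg, and_comm] using hxx
        · simpa [RAM.forLoop, Prog.warr] using ha
        · simpa [RAM.forLoop, Prog.emits] using ho
      obtain ⟨u, s₂, hy, hu, hN⟩ := ih (j + 1) _ (by lia) hf'
        (by simp [State.setReg]) hinv'
      refine ⟨_, s₂, .loop_true ?_ hx' hy, ?_, hN⟩
      · simp only [Expr.eval, he s' hf, hr]
        lia
      · have : t + 4 ≤ (Prog.seq c (.assign i (.plus (.reg i) (.lit 1)))).time B := by
          simp only [Prog.time, Expr.cost]
          lia
        rw [add_mul (m + 1) 1, one_mul]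
        lia
  obtain ⟨t, s', hx, ht, hN⟩ := main N 0 (s.setReg i 0) rfl hset (by simp [State.setReg]) h0
  have hx' : Exec (RAM.forLoop i e c) s (2 + t) s' := .seq (.assign i (.lit 0) s) hx
  refine ⟨_, s', hx', ?_, hQ s' hx'.frame hN⟩
  simp only [RAM.forLoop, Prog.time, Expr.cost] at ht ⊢
  have := Nat.mul_le_mul_right (e.cost + 1 + 1 + 1 + (c.time B + (1 + 1 + 1 + 1)))
    (Nat.add_le_add_right hB 1)
  lia

end RAM

/-! ### Flows on spanning forests -/

/-- A rooted spanning forest whose trees span the connected components. A node is a root if it is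
its own parent. Nodes are ranked in the order of discovery, component by component. -/
structure RankedForest {V : Type*} (G : SimpleGraph V) where
  par : V → V
  rank : V → ℕ
  rank_injective : Function.Injective rank
  adj_par : ∀ x, par x ≠ x → G.Adj x (par x)
  rank_par_lt : ∀ x, par x ≠ x → rank (par x) < rank x
  rank_lt_of_adj : ∀ x, par x = x → ∀ u v, G.Adj u v → rank u < rank x → rank v < rank x

namespace RankedForest

variable {V : Type*} [Fintype V] [DecidableEq V] {G : SimpleGraph V} (F : RankedForest G)

/-- The children of a node. -/
def children (x : V) : Finset V := {y | F.par y ≠ y ∧ F.par y = x}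

theorem sum_sum_children {M : Type*} [AddCommMonoid M] (h : V → M) (U : Finset V) :
    ∑ x ∈ U, ∑ y ∈ F.children x, h y = ∑ y with F.par y ≠ y ∧ F.par y ∈ U, h y := by
  rw [← Finset.sum_biUnion]
  · refine Finset.sum_congr ?_ fun _ _ => rfl
    ext y
    simp only [children, Finset.mem_biUnion, Finset.mem_filter, Finset.mem_univ, true_and]
    grind
  · intro x _ x' _ hne
    simp only [Function.onFun, Finset.disjoint_left, children, Finset.mem_filter]
    grind

/-- Subtrees need not be defined: sum the recursion over all nodes of rank at least that of `x`.
Their children lie in the same set and differ from `x`, so after cancellation `a x` is bounded by a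
sum of values of `d`. -/
theorem subtreeSum_le_card {a d : V → ℕ} (ha : ∀ x, a x = d x + ∑ y ∈ F.children x, a y)
    (hd : ∀ x, d x ≤ 1) (x : V) : a x ≤ Fintype.card V := by
  let U : Finset V := {y | F.rank x ≤ F.rank y}
  have h₁ : ∑ y ∈ U, a y = ∑ y ∈ U, d y + ∑ y with F.par y ≠ y ∧ F.par y ∈ U, a y := by
    rw [← F.sum_sum_children, ← Finset.sum_add_distrib]
    exact Finset.sum_congr rfl fun y _ => ha y
  have hx : x ∈ U := by simp [U]
  have h₂ : ∑ y with F.par y ≠ y ∧ F.par y ∈ U, a y ≤ ∑ y ∈ U.erase x, a y := by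
    refine Finset.sum_le_sum_of_subset fun y hy => ?_
    simp only [U, Finset.mem_filter, Finset.mem_univ, true_and, Finset.mem_erase] at hy ⊢
    have := F.rank_par_lt y hy.1
    refine ⟨?_, by lia⟩
    rintro rfl
    lia
  have h₃ := Finset.add_sum_erase U a hx
  have h₄ : ∑ y ∈ U, d y ≤ Fintype.card V := calc
    ∑ y ∈ U, d y ≤ ∑ y ∈ U, 1 := Finset.sum_le_sum fun y _ => hd y
    _ = U.card := by simp
    _ ≤ Fintype.card V := Finset.card_le_univ U
  lia

/-- Take the root `r` of largest rank with nonzero flow. The nodes ranked from `r` onwards form a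
union of components, and summing the recursion over them leaves only the flows at their roots. Among
these only `f r` can be nonzero, yet the total is zero. -/
theorem root_eq_zero {f d : V → ℤ} (hf : ∀ x, f x = d x + ∑ y ∈ F.children x, f y)
    (hd : ∀ U : Finset V, (∀ u v, G.Adj u v → u ∈ U → v ∈ U) → ∑ x ∈ U, d x = 0)
    (x : V) (hx : F.par x = x) : f x = 0 := by
  by_contra hne
  obtain ⟨r, hr, hmax⟩ := Finset.exists_max_image {y | F.par y = y ∧ f y ≠ 0} F.rank
    ⟨x, by simp [hx, hne]⟩
  simp only [Finset.mem_filter, Finset.mem_univ, true_and] at hr hmax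
  let U : Finset V := {y | F.rank r ≤ F.rank y}
  have hU : ∀ u v, G.Adj u v → u ∈ U → v ∈ U := by
    intro u v huv hu
    simp only [U, Finset.mem_filter, Finset.mem_univ, true_and] at hu ⊢
    by_contra! hv
    exact absurd (F.rank_lt_of_adj r hr.1 v u huv.symm hv) (by lia)
  have h₁ : ∑ y ∈ U, f y = ∑ y ∈ U, d y + ∑ y with F.par y ≠ y ∧ F.par y ∈ U, f y := by
    rw [← F.sum_sum_children, ← Finset.sum_add_distrib]
    exact Finset.sum_congr rfl fun y _ => hf y
  have h₂ : ({y | F.par y ≠ y ∧ F.par y ∈ U} : Finset V) = U.filter fun y => F.par y ≠ y := by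
    ext y
    simp only [Finset.mem_filter, Finset.mem_univ, true_and]
    constructor
    · exact fun h => ⟨hU _ _ (F.adj_par y h.1).symm h.2, h.1⟩
    · exact fun h => ⟨h.2, hU _ _ (F.adj_par y h.2) h.1⟩
  have h₃ := Finset.sum_filter_add_sum_filter_not U (fun y => F.par y ≠ y) f
  have h₄ : ∑ y ∈ U with ¬ F.par y ≠ y, f y = f r := by
    refine Finset.sum_eq_single_of_mem r (by simp [U, hr.1]) fun y hy hyr => ?_
    simp only [U, ne_eq, not_not, Finset.mem_filter, Finset.mem_univ, true_and] at hy
    by_contra hfy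
    exact hyr (F.rank_injective (le_antisymm (hmax y ⟨hy.2, hfy⟩) hy.1))
  rw [hd U hU, h₂] at h₁
  exact hr.2 (by lia)

/-- If the flow `f` along the forest carries the tokens on `S` to `T`, and no token can move along
an edge in the direction of the flow, then all tokens have arrived. -/
theorem eq_of_stuck {f : V → ℤ} {S T : Finset V} (hcard : S.card = T.card)
    (hf : ∀ x, f x = ((if x ∈ S then 1 else 0) - (if x ∈ T then 1 else 0)) +
      ∑ y ∈ F.children x, f y)
    (hroot : ∀ x, F.par x = x → f x = 0)
    (hup : ∀ x, 0 < f x → x ∈ S → F.par x ∈ S)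
    (hdown : ∀ x, f x < 0 → F.par x ∈ S → x ∈ S) : S = T := by
  -- Conservation summed over the occupied set: the net flow out of `S` equals the number of tokens
  -- of `S` that are not on `T`.
  have h₁ : ∑ y ∈ S, f y = ∑ y ∈ S, ((if y ∈ S then 1 else 0) - (if y ∈ T then 1 else 0) : ℤ) +
      ∑ y with F.par y ≠ y ∧ F.par y ∈ S, f y := by
    rw [← F.sum_sum_children, ← Finset.sum_add_distrib]
    exact Finset.sum_congr rfl fun y _ => hf y
  -- Edges inside `S` cancel (`e₁`). Being stuck, an edge leaving `S` upwards has no positive flow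
  -- (`e₂`), and an edge leaving `S` downwards has no negative flow (`e₃`), so the net outflow is at
  -- most zero.
  have h₂ : ∑ y ∈ S, f y ≤ ∑ y with F.par y ≠ y ∧ F.par y ∈ S, f y := by
    rw [← Finset.sum_filter_add_sum_filter_not S (fun y => F.par y ∈ S),
      ← Finset.sum_filter_add_sum_filter_not
        ({y | F.par y ≠ y ∧ F.par y ∈ S} : Finset V) (fun y => y ∈ S)]
    have e₁ : ∑ y ∈ S with F.par y ∈ S, f y =
        ∑ y ∈ ({y | F.par y ≠ y ∧ F.par y ∈ S} : Finset V) with y ∈ S, f y := by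
      symm
      refine Finset.sum_subset (fun y hy => ?_) fun y hy hy' => hroot y ?_
      · simp only [Finset.mem_filter, Finset.mem_univ, true_and] at hy ⊢
        exact ⟨hy.2, hy.1.2⟩
      · simp only [Finset.mem_filter, Finset.mem_univ, true_and] at hy hy'
        by_contra h
        exact hy' ⟨⟨h, hy.2⟩, hy.1⟩
    have e₂ : ∑ y ∈ S with ¬ F.par y ∈ S, f y ≤ 0 := by
      refine Finset.sum_nonpos fun y hy => ?_
      simp only [Finset.mem_filter] at hy
      by_contra! h
      exact hy.2 (hup y h hy.1)
    have e₃ : 0 ≤ ∑ y ∈ ({y | F.par y ≠ y ∧ F.par y ∈ S} : Finset V) with ¬ y ∈ S, f y := by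
      refine Finset.sum_nonneg fun y hy => ?_
      simp only [Finset.mem_filter, Finset.mem_univ, true_and] at hy
      by_contra! h
      exact hy.2 (hdown y h hy.1.2)
    lia
  have h₃ : ∀ y ∈ S, (0 : ℤ) ≤ (if y ∈ S then 1 else 0) - (if y ∈ T then 1 else 0) := by
    intro y hy
    split_ifs <;> simp
  have h₄ := (Finset.sum_eq_zero_iff_of_nonneg h₃).1
    (le_antisymm (by lia) (Finset.sum_nonneg h₃))
  refine Finset.eq_of_subset_of_card_le (fun y hy => ?_) hcard.ge
  have := h₄ y hy
  by_contra h
  simp [hy, h] at this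

/-- Changing the flow on one edge by `δ` affects the balance only at its two ends, with opposite
signs. -/
theorem conservation_update {f d d' : V → ℤ} (hf : ∀ x, f x = d x + ∑ y ∈ F.children x, f y)
    {x : V} (hx : F.par x ≠ x) {δ : ℤ}
    (hd : ∀ v, d' v = d v + (if v = x then δ else 0) - (if v = F.par x then δ else 0)) (v : V) :
    Function.update f x (f x + δ) v =
      d' v + ∑ y ∈ F.children v, Function.update f x (f x + δ) y := by
  have e : ∀ y, Function.update f x (f x + δ) y = f y + if y = x then δ else 0 := by
    intro y
    by_cases h : y = x
    · subst h; simp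
    · simp [h]
  have hs : ∑ y ∈ F.children v, Function.update f x (f x + δ) y =
      ∑ y ∈ F.children v, f y + if v = F.par x then δ else 0 := by
    simp only [e, Finset.sum_add_distrib, Finset.sum_ite_eq']
    congr 1
    simp only [children, Finset.mem_filter, Finset.mem_univ, true_and]
    grind
  rw [hs, e, hf v, hd v]
  lia

end RankedForest

/-! ### Building routes by appending nodes and waits -/

namespace Route

variable {n : ℕ}

/-- The route without actions. -/
def single (v : Fin n) : Route n := ⟨0, fun _ => v⟩

/-- The route `ρ` followed by one more node. -/
def snoc (ρ : Route n) (v : Fin n) : Route n :=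
  ⟨ρ.len + 1, fun j => if j ≤ ρ.len then ρ.node j else v⟩

/-- The last node. -/
def last (ρ : Route n) : Fin n := ρ.node ρ.len

/-- The route `ρ` followed by `c` time units of waiting. -/
def stay (ρ : Route n) : ℕ → Route n
  | 0 => ρ
  | c + 1 => (ρ.stay c).snoc ρ.last

/-- The nodes of a route as they are written to the output stream. -/
def nodes (ρ : Route n) : List ℕ := (List.range (ρ.len + 1)).map fun j => (ρ.node j : ℕ) + 1

@[simp] theorem last_single (v : Fin n) : (single v).last = v := rfl

@[simp] theorem last_snoc (ρ : Route n) (v : Fin n) : (ρ.snoc v).last = v := by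
  simp [last, snoc]

@[simp] theorem last_stay (ρ : Route n) (c : ℕ) : (ρ.stay c).last = ρ.last := by
  cases c with
  | zero => rfl
  | succ c => exact last_snoc _ _

theorem node_snoc_of_le {ρ : Route n} {v : Fin n} {j : ℕ} (hj : j ≤ ρ.len) :
    (ρ.snoc v).node j = ρ.node j := if_pos hj

@[simp] theorem node_zero_snoc (ρ : Route n) (v : Fin n) : (ρ.snoc v).node 0 = ρ.node 0 :=
  node_snoc_of_le (Nat.zero_le _)

@[simp] theorem node_zero_stay (ρ : Route n) (c : ℕ) : (ρ.stay c).node 0 = ρ.node 0 := by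
  induction c with
  | zero => rfl
  | succ c ih => rw [stay, node_zero_snoc, ih]

@[simp] theorem nodes_single (v : Fin n) : (single v).nodes = [(v : ℕ) + 1] := rfl

@[simp] theorem nodes_snoc (ρ : Route n) (v : Fin n) : (ρ.snoc v).nodes = ρ.nodes ++ [(v : ℕ) + 1] := by
  rw [nodes, nodes, show (ρ.snoc v).len + 1 = (ρ.len + 1) + 1 from rfl, List.range_succ,
    List.map_append]
  congr 1
  · refine List.map_congr_left fun j hj => ?_
    rw [node_snoc_of_le (by simpa [Nat.lt_succ_iff] using hj)]
  · simp [snoc]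

end Route

namespace AMAPF

variable {I : AMAPF}

/-- The time at which a route ends. -/
def finish (I : AMAPF) (ρ : Route I.n) : ℕ := I.arrival ρ ρ.len

/-- The route reaches the node `v` at time `t`. -/
def Visits (I : AMAPF) (ρ : Route I.n) (v : Fin I.n) (t : ℕ) : Prop :=
  ∃ j ≤ ρ.len, ρ.node j = v ∧ I.arrival ρ j = t

theorem arrival_snoc {ρ : Route I.n} {v : Fin I.n} {j : ℕ} (hj : j ≤ ρ.len) :
    I.arrival (ρ.snoc v) j = I.arrival ρ j := by
  refine Finset.sum_congr rfl fun i hi => ?_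
  rw [Finset.mem_range] at hi
  rw [Route.node_snoc_of_le (by lia), Route.node_snoc_of_le (by lia)]

theorem finish_snoc (ρ : Route I.n) (v : Fin I.n) :
    I.finish (ρ.snoc v) = I.finish ρ + I.duration ρ.last v := by
  have h : I.arrival (ρ.snoc v) ρ.len = I.arrival ρ ρ.len := arrival_snoc le_rfl
  rw [arrival] at h
  rw [finish, arrival, show (ρ.snoc v).len = ρ.len + 1 from rfl, Finset.sum_range_succ, h]
  simp [Route.snoc, finish, Route.last]

theorem finish_stay (ρ : Route I.n) (c : ℕ) : I.finish (ρ.stay c) = I.finish ρ + c := by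
  induction c with
  | zero => rfl
  | succ c ih =>
    rw [Route.stay, finish_snoc, ih, Route.last_stay, duration, if_pos rfl, add_assoc]

theorem visits_snoc {ρ : Route I.n} {v w : Fin I.n} {t : ℕ} :
    I.Visits (ρ.snoc v) w t ↔ I.Visits ρ w t ∨ (w = v ∧ t = I.finish (ρ.snoc v)) := by
  constructor
  · rintro ⟨j, hj, hw, ht⟩
    obtain h | rfl : j ≤ ρ.len ∨ j = ρ.len + 1 := Nat.le_or_eq_of_le_succ hj
    · exact .inl ⟨j, h, by rwa [Route.node_snoc_of_le h] at hw, by rwa [arrival_snoc h] at ht⟩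
    · exact .inr ⟨hw.symm.trans (Route.last_snoc ρ v), ht.symm⟩
  · rintro (⟨j, hj, hw, ht⟩ | ⟨rfl, rfl⟩)
    · exact ⟨j, Nat.le_succ_of_le hj, by rwa [Route.node_snoc_of_le hj], by rwa [arrival_snoc hj]⟩
    · exact ⟨ρ.len + 1, le_rfl, Route.last_snoc ρ w, rfl⟩

theorem visits_stay {ρ : Route I.n} {v : Fin I.n} {c t : ℕ} (h : I.Visits (ρ.stay c) v t) :
    I.Visits ρ v t ∨ (v = ρ.last ∧ I.finish ρ < t ∧ t ≤ I.finish ρ + c) := by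
  induction c with
  | zero => exact .inl h
  | succ c ih =>
    rcases visits_snoc.1 h with h | ⟨rfl, rfl⟩
    · rcases ih h with h | h
      · exact .inl h
      · exact .inr ⟨h.1, h.2.1, by lia⟩
    · have := finish_stay ρ (c + 1)
      rw [Route.stay] at this
      exact .inr ⟨rfl, by lia⟩

theorem traverses_snoc {ρ : Route I.n} {v u w : Fin I.n} {t : ℕ}
    (h : I.Traverses (ρ.snoc v) u w t) :
    I.Traverses ρ u w t ∨ (ρ.last ≠ v ∧ I.finish ρ ≤ t ∧ t < I.finish (ρ.snoc v)) := by
  obtain ⟨j, hj, hu, hw, hne, h₁, h₂⟩ := h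
  obtain h | rfl : j < ρ.len ∨ j = ρ.len := Nat.lt_or_eq_of_le (Nat.lt_succ_iff.1 hj)
  · rw [Route.node_snoc_of_le h.le] at hu
    rw [Route.node_snoc_of_le h] at hw
    rw [arrival_snoc h.le] at h₁
    rw [arrival_snoc h] at h₂
    exact .inl ⟨j, h, hu, hw, hne, h₁, h₂⟩
  · rw [Route.node_snoc_of_le le_rfl] at hu
    rw [arrival_snoc le_rfl] at h₁
    refine .inr ⟨fun hv => hne ?_, h₁, h₂⟩
    exact (hu.symm.trans hv).trans ((Route.last_snoc ρ v).symm.trans hw)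

theorem traverses_stay {ρ : Route I.n} {u v : Fin I.n} {c t : ℕ}
    (h : I.Traverses (ρ.stay c) u v t) : I.Traverses ρ u v t := by
  induction c with
  | zero => exact h
  | succ c ih =>
    rcases traverses_snoc h with h | h
    · exact ih h
    · simp at h

theorem IsWalk.snoc {ρ : Route I.n} (h : I.IsWalk ρ) {v : Fin I.n}
    (hv : ρ.last = v ∨ I.graph.Adj ρ.last v) : I.IsWalk (ρ.snoc v) := by
  intro j hj
  obtain hl | rfl : j < ρ.len ∨ j = ρ.len := Nat.lt_or_eq_of_le (Nat.lt_succ_iff.1 hj)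
  · rw [Route.node_snoc_of_le hl.le, Route.node_snoc_of_le hl]
    exact h j hl
  · rw [Route.node_snoc_of_le le_rfl,
      show (ρ.snoc v).node (ρ.len + 1) = v from Route.last_snoc ρ v]
    exact hv

theorem IsWalk.stay {ρ : Route I.n} (h : I.IsWalk ρ) (c : ℕ) : I.IsWalk (ρ.stay c) := by
  induction c with
  | zero => exact h
  | succ c ih => exact ih.snoc (.inl (by simp))

/-! ### Serial moves and the synchronous routes they induce -/

/-- A move: the agent, the node it moves to, and the time it needs. -/
abbrev Move (I : AMAPF) : Type := Fin I.k × Fin I.n × ℕ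

/-- How the route of agent `i` continues during a move. After the move everyone waits for one
more time unit, so that also moves that take no time do not interfere. -/
def stepRoute (i : Fin I.k) (ρ : Route I.n) (m : I.Move) : Route I.n :=
  if m.1 = i then (ρ.snoc m.2.1).snoc m.2.1 else ρ.stay (m.2.2 + 1)

/-- The route of agent `i` when the moves `l` are made one after the other. -/
def routeOf (l : List I.Move) (i : Fin I.k) : Route I.n :=
  l.foldl (stepRoute i) (.single (I.start i))

/-- The moves `l` lead, along edges to unoccupied nodes, from the start nodes to the positions
`c`. -/
inductive Leads (I : AMAPF) : List I.Move → (Fin I.k → Fin I.n) → Prop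
  | nil : Leads I [] I.start
  | snoc {l : List I.Move} {c : Fin I.k → Fin I.n} (a : Fin I.k) (v : Fin I.n) :
      Leads I l c → I.graph.Adj (c a) v → (∀ i, c i ≠ v) →
      Leads I (l ++ [(a, v, I.weight (c a) v)]) (Function.update c a v)

theorem Leads.injective {l : List I.Move} {c : Fin I.k → Fin I.n} (h : I.Leads l c) :
    Function.Injective c := by
  induction h with
  | nil => exact I.start.injective
  | snoc a v _ _ hv ih =>
    intro i j hij
    simp only [Function.update_apply] at hij
    grind [Function.Injective]

/-- Synchronous collision-free routes that end at time `T` in the positions `c`. -/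
structure Synchronous (ρ : Fin I.k → Route I.n) (c : Fin I.k → Fin I.n) (T : ℕ) : Prop where
  isWalk : ∀ i, I.IsWalk (ρ i)
  start : ∀ i, (ρ i).node 0 = I.start i
  last : ∀ i, (ρ i).last = c i
  finish : ∀ i, I.finish (ρ i) = T
  visits : ∀ i v t, I.Visits (ρ i) v t → t < T ∨ (t = T ∧ v = c i)
  traverses : ∀ i u v t, I.Traverses (ρ i) u v t → t < T
  node : ∀ i j v t, i ≠ j → I.Visits (ρ i) v t → ¬ I.Visits (ρ j) v t
  edge : ∀ i j u v u' v' t, i ≠ j → I.Traverses (ρ i) u v t → ¬ I.Traverses (ρ j) u' v' t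

/-- With weight zero the mover visits both ends of its edge at time `T`. The extra unit of waiting
restores the invariant that at the common end time every agent is only at its current position. -/
theorem Synchronous.step {ρ : Fin I.k → Route I.n} {c : Fin I.k → Fin I.n} {T : ℕ}
    (h : Synchronous ρ c T) (hc : Function.Injective c) {a : Fin I.k} {v : Fin I.n}
    (hadj : I.graph.Adj (c a) v) (hv : ∀ i, c i ≠ v) :
    Synchronous (fun i => stepRoute i (ρ i) (a, v, I.weight (c a) v)) (Function.update c a v)
      (T + I.weight (c a) v + 1) := by
  have hf : I.finish ((ρ a).snoc v) = T + I.weight (c a) v := by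
    rw [finish_snoc, h.finish, h.last, duration, if_neg hadj.ne]
  have hf' : I.finish (((ρ a).snoc v).snoc v) = T + I.weight (c a) v + 1 := by
    rw [finish_snoc, hf, Route.last_snoc, duration, if_pos rfl]
  -- Only the mover can have a new visit at time `T` itself; the new visits of the others are waits,
  -- which end strictly later.
  have hvis : ∀ i w t, I.Visits (stepRoute i (ρ i) (a, v, I.weight (c a) v)) w t →
      I.Visits (ρ i) w t ∨ (w = Function.update c a v i ∧ T ≤ t ∧ (i ≠ a → T < t) ∧
        t ≤ T + I.weight (c a) v + 1) := by
    intro i w t hw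
    by_cases hi : a = i
    · subst hi
      simp only [stepRoute, if_true, visits_snoc, hf, hf'] at hw
      rw [Function.update_self]
      rcases hw with (hw | hw) | hw
      · exact .inl hw
      · exact .inr ⟨hw.1, by lia, by lia, by lia⟩
      · exact .inr ⟨hw.1, by lia, by lia, by lia⟩
    · simp only [stepRoute, if_neg hi] at hw
      rw [Function.update_of_ne (Ne.symm hi), ← h.last]
      rcases visits_stay hw with hw | hw
      · exact .inl hw
      · rw [h.finish] at hw
        exact .inr ⟨hw.1, by lia, by lia, by lia⟩
  have htra : ∀ i u w t, I.Traverses (stepRoute i (ρ i) (a, v, I.weight (c a) v)) u w t →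
      I.Traverses (ρ i) u w t ∨ (i = a ∧ T ≤ t ∧ t < T + I.weight (c a) v) := by
    intro i u w t hw
    by_cases hi : a = i
    · subst hi
      simp only [stepRoute, if_true] at hw
      rcases traverses_snoc hw with hw | hw
      · rcases traverses_snoc hw with hw | hw
        · exact .inl hw
        · rw [hf, h.finish] at hw
          exact .inr ⟨rfl, hw.2⟩
      · simp at hw
    · simp only [stepRoute, if_neg hi] at hw
      exact .inl (traverses_stay hw)
  refine ⟨fun i => ?_, fun i => ?_, fun i => ?_, fun i => ?_, fun i w t hw => ?_,
    fun i u w t hw => ?_, fun i j w t hij hi hj => ?_, fun i j u w u' w' t hij hi hj => ?_⟩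
  · simp only [stepRoute]
    split_ifs with hi
    · subst hi
      exact ((h.isWalk a).snoc (.inr (by rwa [h.last]))).snoc (.inl (by simp))
    · exact (h.isWalk i).stay _
  · simp only [stepRoute]
    split_ifs <;> simp [h.start]
  · simp only [stepRoute]
    split_ifs with hi
    · subst hi
      simp
    · simp [h.last, Function.update_of_ne (Ne.symm hi)]
  · simp only [stepRoute]
    split_ifs with hi
    · subst hi
      exact hf'
    · rw [finish_stay, h.finish, add_assoc]
  · rcases hvis i w t hw with hw | hw
    · have := h.visits i w t hw
      lia
    · rcases hw.2.2.2.lt_or_eq with ht | ht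
      · exact .inl ht
      · exact .inr ⟨ht, hw.1⟩
  · rcases htra i u w t hw with hw | hw
    · have := h.traverses i u w t hw
      lia
    · lia
  -- An old and a new visit can coincide only at time `T`, when the new one is by the mover at `v`;
  -- but then `v` would have been occupied.
  · have key : ∀ i j, i ≠ j → I.Visits (ρ i) w t → w = Function.update c a v j → T ≤ t →
        (j ≠ a → T < t) → False := by
      intro i j hij hi hj ht ht'
      rcases h.visits i w t hi with hi | hi
      · lia
      · rw [hi.2] at hj
        by_cases hja : j = a
        · subst hja
          rw [Function.update_self] at hj
          exact hv i hj
        · lia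
    rcases hvis i w t hi with hi | hi <;> rcases hvis j w t hj with hj | hj
    · exact h.node i j w t hij hi hj
    · exact key i j hij hi hj.1 hj.2.1 hj.2.2.1
    · exact key j i hij.symm hj hi.1 hi.2.1 hi.2.2.1
    · have := hi.1.symm.trans hj.1
      simp only [Function.update_apply] at this
      grind [Function.Injective]
  · rcases htra i u w t hi with hi | hi <;> rcases htra j u' w' t hj with hj | hj
    · exact h.edge i j u w u' w' t hij hi hj
    · have := h.traverses i u w t hi
      lia
    · have := h.traverses j u' w' t hj
      lia
    · exact hij (hi.1.trans hj.1.symm)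

theorem Leads.synchronous {l : List I.Move} {c : Fin I.k → Fin I.n} (h : I.Leads l c) :
    ∃ T, Synchronous (routeOf l) c T := by
  induction h with
  | nil =>
    have hvis : ∀ i v t, I.Visits (routeOf [] i) v t → t = 0 ∧ v = I.start i := by
      rintro i v t ⟨j, hj, hv, ht⟩
      obtain rfl : j = 0 := Nat.le_zero.1 hj
      exact ⟨ht.symm, hv.symm⟩
    have htra : ∀ i u v t, ¬ I.Traverses (routeOf [] i) u v t := by
      rintro i u v t ⟨j, hj, -⟩
      exact absurd hj (Nat.not_lt_zero j)
    refine ⟨0, fun i j hj => absurd hj (Nat.not_lt_zero j), fun i => rfl, fun i => rfl,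
      fun i => rfl, fun i v t h => .inr (hvis i v t h), fun i u v t h => (htra i u v t h).elim,
      fun i j v t hij hi hj => hij (I.start.injective ?_),
      fun i j u v u' v' t hij hi => (htra i u v t hi).elim⟩
    exact (hvis i v t hi).2.symm.trans (hvis j v t hj).2
  | @snoc l c a v hl hadj hv ih =>
    obtain ⟨T, hT⟩ := ih
    have e : routeOf (l ++ [(a, v, I.weight (c a) v)]) =
        fun i => stepRoute i (routeOf l i) (a, v, I.weight (c a) v) := by
      funext i
      simp [routeOf]
    exact ⟨_, e ▸ hT.step hl.injective hadj hv⟩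

theorem LocatedAt.visits_or {ρ : Route I.n} {v : Fin I.n} {t : ℕ} (h : I.LocatedAt ρ v t) :
    I.Visits ρ v t ∨ (v = ρ.last ∧ I.finish ρ ≤ t) := by
  obtain ⟨j, hj, hv, ht | ⟨rfl, ht⟩⟩ := h
  · exact .inl ⟨j, hj, hv, ht⟩
  · exact .inr ⟨hv.symm, ht⟩

/-- All routes end at the same time, so the infinite stay at the last node adds no conflict beyond
the injectivity of `c`. The permutation is read off from the final positions. -/
theorem Leads.isCorrectAnswer {l : List I.Move} {c : Fin I.k → Fin I.n} (h : I.Leads l c)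
    (hc : Set.range c = Set.range I.goal) : I.IsCorrectAnswer (some (routeOf l)) := by
  obtain ⟨T, hT⟩ := h.synchronous
  refine ⟨⟨fun i => ⟨hT.isWalk i, hT.start i⟩, ?_⟩, fun i j hij => ⟨?_, ?_⟩⟩
  · have : ∀ i, ∃ j, I.goal j = c i := fun i => by
      rw [← Set.mem_range, ← hc]
      exact ⟨i, rfl⟩
    choose σ hσ using this
    have hinj : Function.Injective σ := fun i j hij => h.injective (by rw [← hσ, hij, hσ])
    exact ⟨Equiv.ofBijective σ (Finite.injective_iff_bijective.1 hinj), fun i =>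
      (hT.last i).trans (hσ i).symm⟩
  · rintro ⟨v, t, hi, hj⟩
    have key : ∀ i j, i ≠ j → I.Visits (routeOf l i) v t → v = (routeOf l j).last →
        I.finish (routeOf l j) ≤ t → False := by
      intro i j hij hi hj ht
      rw [hT.finish] at ht
      rw [hT.last] at hj
      rcases hT.visits i v t hi with hi | hi
      · lia
      · exact hij (h.injective (hi.2.symm.trans hj))
    rcases hi.visits_or with hi | hi <;> rcases hj.visits_or with hj | hj
    · exact hT.node i j v t hij hi hj
    · exact key i j hij hi hj.1 hj.2
    · exact key j i hij.symm hj hi.1 hi.2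
    · have := hi.1.symm.trans hj.1
      rw [hT.last, hT.last] at this
      exact hij (h.injective this)
  · rintro ⟨u, v, t, hi, hj | hj⟩
    · exact hT.edge i j _ _ _ _ t hij hi hj
    · exact hT.edge i j _ _ _ _ t hij hi hj

/-! ### The necessary condition: balance on components -/

theorem IsWalk.mem_iff {ρ : Route I.n} (h : I.IsWalk ρ) {U : Finset (Fin I.n)}
    (hU : ∀ u v, I.graph.Adj u v → u ∈ U → v ∈ U) : ρ.node 0 ∈ U ↔ ρ.last ∈ U := by
  have : ∀ j ≤ ρ.len, ρ.node 0 ∈ U ↔ ρ.node j ∈ U := by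
    intro j
    induction j with
    | zero => exact fun _ => Iff.rfl
    | succ j ih =>
      intro hj
      rw [ih (by lia)]
      rcases h j hj with h | h
      · rw [h]
      · exact ⟨hU _ _ h, hU _ _ h.symm⟩
  exact this _ le_rfl

/-- Each route starts in `U` if and only if it ends there, so starts and goals in `U` are
equinumerous. Collisions play no role, which is why the negative answer excludes them too. -/
theorem IsRouting.sum_eq_zero {π : Fin I.k → Route I.n} (h : I.IsRouting π)
    {U : Finset (Fin I.n)} (hU : ∀ u v, I.graph.Adj u v → u ∈ U → v ∈ U) :
    ∑ x ∈ U, ((if ∃ i, I.start i = x then 1 else 0) - (if ∃ i, I.goal i = x then 1 else 0) : ℤ)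
      = 0 := by
  obtain ⟨hwalk, σ, hσ⟩ := h
  have count : ∀ g : Fin I.k ↪ Fin I.n, ∑ x ∈ U, (if ∃ i, g i = x then 1 else 0 : ℤ) =
      ∑ i, if g i ∈ U then 1 else 0 := by
    intro g
    rw [Finset.sum_boole, Finset.sum_boole]
    congr 1
    rw [← Finset.card_map g]
    congr 1
    ext x
    simp only [Finset.mem_filter, Finset.mem_map, Finset.mem_univ, true_and]
    grind
  rw [Finset.sum_sub_distrib, count, count,
    ← Equiv.sum_comp σ fun i => if I.goal i ∈ U then (1 : ℤ) else 0, ← Finset.sum_sub_distrib]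
  refine Finset.sum_eq_zero fun i _ => ?_
  have := (hwalk i).1.mem_iff hU
  rw [(hwalk i).2, Route.last, hσ i] at this
  simp [this]

end AMAPF

/-! ### Access to the instance in memory -/

namespace AMAPF

open RAM

local infixr:60 " ;; " => Prog.seq

/-- The test whether two values are different. -/
def neExpr (e₁ e₂ : Expr) : Expr := .plus (.minus e₁ e₂) (.minus e₂ e₁)

@[simp] theorem neExpr_eval (e₁ e₂ : Expr) (s : State) :
    (neExpr e₁ e₂).eval s = 0 ↔ e₁.eval s = e₂.eval s := by
  simp only [neExpr, Expr.eval]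
  lia

theorem vectorArray_fin {k : ℕ} (v : Fin k → ℕ) (i : Fin k) : vectorArray v i = v i := by
  simp [vectorArray]

theorem matrixArray_fin {n : ℕ} (M : Fin n → Fin n → ℕ) (u v : Fin n) :
    matrixArray M (u * n + v) = M u v := by
  have h : (u : ℕ) * n + v < n * n := by
    have := Nat.mul_le_mul_right n (Nat.succ_le_of_lt u.2)
    rw [Nat.succ_mul] at this
    have := v.2
    lia
  have hn : 0 < n := u.pos
  rw [matrixArray, vectorArray, dif_pos h]
  congr 1 <;> ext
  · simp only [Fin.divNat]
    rw [mul_comm, Nat.mul_add_div hn, Nat.div_eq_of_lt v.2, add_zero]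
  · simp only [Fin.modNat]
    rw [mul_comm, Nat.mul_add_mod, Nat.mod_eq_of_lt v.2]

/-- The state contains the instance. Array 4 holds the offsets of the rows in the matrices, and
register 2 the number of entries of a matrix. -/
structure Loaded (I : AMAPF) (s : State) : Prop where
  n : s.reg 0 = I.n
  k : s.reg 1 = I.k
  sq : s.reg 2 = I.n * I.n
  adj : ∀ u v : Fin I.n, s.arr 0 (s.arr 4 u + v) = 0 ↔ ¬ I.graph.Adj u v
  weight : ∀ u v : Fin I.n, I.graph.Adj u v → s.arr 1 (s.arr 4 u + v) = I.weight u v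
  start : ∀ i : Fin I.k, s.arr 2 i = I.start i
  goal : ∀ i : Fin I.k, s.arr 3 i = I.goal i

/-- The program does not change the instance. -/
def keepsInstance (c : Prog) : Bool :=
  !(c.wreg 0 || c.wreg 1 || c.wreg 2 || c.warr 0 || c.warr 1 || c.warr 2 || c.warr 3 || c.warr 4)

variable {I : AMAPF} {B : ℕ} {s : State}

theorem Loaded.frame {c : Prog} {s' : State} (h : Loaded I s) (hf : Frame c s s')
    (hc : keepsInstance c = true) : Loaded I s' := by
  simp only [keepsInstance, Bool.not_eq_true', Bool.or_eq_false_iff] at hc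
  obtain ⟨⟨⟨⟨⟨⟨⟨r0, r1⟩, r2⟩, a0⟩, a1⟩, a2⟩, a3⟩, a4⟩ := hc
  constructor
  · rw [hf.reg 0 r0, h.n]
  · rw [hf.reg 1 r1, h.k]
  · rw [hf.reg 2 r2, h.sq]
  · rw [hf.arr 0 a0, hf.arr 4 a4]
    exact h.adj
  · rw [hf.arr 1 a1, hf.arr 4 a4]
    exact h.weight
  · rw [hf.arr 2 a2]
    exact h.start
  · rw [hf.arr 3 a3]
    exact h.goal

/-- Computes the offsets of the rows. -/
def rows : Prog :=
  forLoop 3 (.reg 0) (.store 4 (.reg 3) (.reg 2) ;; .assign 2 (.plus (.reg 2) (.reg 0)))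

/-- Without multiplication the row offsets `u * n` are obtained by repeated addition; the
accumulator ends at `n * n`, which later bounds the number of passes. -/
theorem runs_rows (hB : I.n ≤ B) : Runs B rows I.input (Loaded I) := by
  refine Runs.forLoop I.n (fun j s => s.reg 2 = j * I.n ∧ ∀ u < j, s.arr 4 u = u * I.n) rfl hB
    (fun s' hf => hf.reg 0 rfl) ⟨by simp [State.setReg, input], by simp⟩ ?_ ?_
  · rintro j s hj hf h3 ⟨h2, h4⟩
    have h0 : s.reg 0 = I.n := hf.reg 0 rfl
    refine Runs.straight rfl ?_
    simp only [State.setReg, Prog.run, Expr.eval, Function.update_apply, h0, h2, h3]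
    refine ⟨by simp [Nat.succ_mul], fun u hu => ?_⟩
    rcases Nat.lt_succ_iff_lt_or_eq.1 hu with hu | rfl
    · simp [hu.ne, h4 u hu]
    · simp
  · rintro s hf ⟨h2, h4⟩
    refine ⟨hf.reg 0 rfl, hf.reg 1 rfl, h2, fun u v => ?_, fun u v huv => ?_, fun i => ?_,
      fun i => ?_⟩
    · rw [hf.arr 0 rfl, h4 u u.2]
      simp [input, matrixArray_fin]
    · rw [hf.arr 1 rfl, h4 u u.2]
      simp [input, matrixArray_fin, huv]
    · rw [hf.arr 2 rfl]
      simp [input, vectorArray_fin]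
    · rw [hf.arr 3 rfl]
      simp [input, vectorArray_fin]

/-! ### The spanning forest

Array 5 holds the rank of a node plus one (0 if the node is not yet discovered), array 6 the
parents, array 7 the nodes by rank. -/

/-- Finds an undiscovered node (register 6), if possible with a discovered neighbour (register 7;
otherwise both registers contain the same node). -/
def candidate : Prog :=
  forLoop 4 (.reg 0) (.ite (.cell 5 (.reg 4)) .skip (.assign 6 (.reg 4) ;; .assign 7 (.reg 4))) ;;
  forLoop 4 (.reg 0) (forLoop 5 (.reg 0)
    (.ite (.cell 5 (.reg 4)) .skip
      (.ite (.cell 5 (.reg 5))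
        (.ite (.cell 0 (.plus (.cell 4 (.reg 4)) (.reg 5)))
          (.assign 6 (.reg 4) ;; .assign 7 (.reg 5)) .skip)
        .skip)))

/-- Grows the spanning forest by one node in each round. -/
def growForest : Prog :=
  forLoop 3 (.reg 0) (candidate ;;
    .store 5 (.reg 6) (.plus (.reg 3) (.lit 1)) ;; .store 6 (.reg 6) (.reg 7) ;;
    .store 7 (.reg 3) (.reg 6))

theorem runs_candidate (hs : Loaded I s) (hB : I.n ≤ B) (hx : ∃ x : Fin I.n, s.arr 5 x = 0) :
    Runs B candidate s fun s' => ∃ x y : Fin I.n, s'.reg 6 = x ∧ s'.reg 7 = y ∧ s.arr 5 x = 0 ∧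
      ((x = y ∧ ∀ u v, I.graph.Adj u v → s.arr 5 u ≠ 0 → s.arr 5 v ≠ 0) ∨
        (I.graph.Adj x y ∧ s.arr 5 y ≠ 0)) := by
  refine Runs.seq (R := fun s' => ∃ x : Fin I.n, s'.reg 6 = x ∧ s'.reg 7 = x ∧ s.arr 5 x = 0) ?_ ?_
  · refine Runs.forLoop I.n (fun j s' => (∃ x : Fin I.n, x < j ∧ s.arr 5 x = 0) →
      ∃ x : Fin I.n, s'.reg 6 = x ∧ s'.reg 7 = x ∧ s.arr 5 x = 0) rfl hB
      (fun s' hf => (hf.reg 0 rfl).trans hs.n) (by simp) ?_ ?_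
    · intro j s' hj hf h4 hinv
      have h5 : s'.arr 5 = s.arr 5 := hf.arr 5 rfl
      refine Runs.straight rfl fun ⟨x, hxj, hx0⟩ => ?_
      simp only [State.setReg, Prog.run, Expr.eval, h4, h5]
      split_ifs with h
      · exact ⟨⟨j, hj⟩, by simp, by simp [h4], h⟩
      · obtain ⟨y, h6, h7, hy⟩ := hinv ⟨x, by
          rcases Nat.lt_succ_iff_lt_or_eq.1 hxj with h' | h'
          · exact h'
          · rw [h'] at hx0
            exact absurd hx0 h, hx0⟩
        exact ⟨y, by simpa using h6, by simpa using h7, hy⟩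
    · intro s' hf hinv
      obtain ⟨x, hx⟩ := hx
      exact hinv ⟨x, x.2, hx⟩
  · intro s₁ hf₁ h₁
    have hs₁ := hs.frame hf₁ rfl
    have h5 : s₁.arr 5 = s.arr 5 := hf₁.arr 5 rfl
    -- Scan invariant, where `D` is the set of pairs already examined: either an edge from an
    -- undiscovered to a discovered node is stored, or `D` contains none.
    let P (D : Fin I.n → Fin I.n → Prop) (s' : State) : Prop :=
      ∃ x y : Fin I.n, s'.reg 6 = x ∧ s'.reg 7 = y ∧ s.arr 5 x = 0 ∧
        ((x = y ∧ ∀ u v, D u v → I.graph.Adj u v → s.arr 5 v ≠ 0 → s.arr 5 u ≠ 0) ∨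
          (I.graph.Adj x y ∧ s.arr 5 y ≠ 0))
    have hP : ∀ {D D' : Fin I.n → Fin I.n → Prop} {s' s'' : State}, s''.reg 6 = s'.reg 6 →
        s''.reg 7 = s'.reg 7 → P D s' → (∀ u v, D' u v → I.graph.Adj u v → s.arr 5 v ≠ 0 →
          s.arr 5 u ≠ 0 ∨ D u v) → P D' s'' := by
      rintro D D' s' s'' e6 e7 ⟨x, y, h6, h7, hx, h⟩ hD
      refine ⟨x, y, e6.trans h6, e7.trans h7, hx, h.imp_left fun ⟨hxy, h⟩ => ⟨hxy, ?_⟩⟩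
      intro u v hu hadj hv
      rcases hD u v hu hadj hv with h' | h'
      · exact h'
      · exact h u v h' hadj hv
    refine Runs.forLoop I.n (fun j s' => P (fun u _ => u < j) s') rfl hB
      (fun s' hf => (hf.reg 0 rfl).trans hs₁.n) ?_ ?_ ?_
    · obtain ⟨x, h6, h7, hx⟩ := h₁
      exact ⟨x, x, h6, h7, hx, .inl ⟨rfl, by simp⟩⟩
    · intro j s₂ hj hf₂ h4 hinv
      have hs₂ := hs₁.frame hf₂ rfl
      have h5' : s₂.arr 5 = s.arr 5 := (hf₂.arr 5 rfl).trans h5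
      refine Runs.forLoop I.n (fun i s' => P (fun u v => u < j ∨ (u = j ∧ v < i)) s') rfl hB
        (fun s' hf => (hf.reg 0 rfl).trans hs₂.n) ?_ ?_ ?_
      · exact hP rfl rfl hinv fun u v h _ _ => .inr (by simpa using h)
      · intro i s₃ hi hf₃ h5i hinv'
        have hs₃ := hs₂.frame hf₃ rfl
        have h5'' : s₃.arr 5 = s.arr 5 := (hf₃.arr 5 rfl).trans h5'
        have h4' : s₃.reg 4 = j := (hf₃.reg 4 rfl).trans h4
        have hadj := hs₃.adj ⟨j, hj⟩ ⟨i, hi⟩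
        have old : (I.graph.Adj ⟨j, hj⟩ ⟨i, hi⟩ → s.arr 5 i ≠ 0 → s.arr 5 j ≠ 0) →
            P (fun u v => u < j ∨ (u = j ∧ v < i + 1)) (s₃.setReg 5 (i + 1)) := by
          intro hji
          refine hP rfl rfl hinv' fun u v h h' h'' => ?_
          by_cases hv : (u : ℕ) = j ∧ (v : ℕ) = i
          · obtain rfl : u = ⟨j, hj⟩ := Fin.ext hv.1
            obtain rfl : v = ⟨i, hi⟩ := Fin.ext hv.2
            exact .inl (hji h' h'')
          · right
            lia
        refine Runs.ite (fun hj0 => .straight rfl (old fun _ _ => ?_)) fun hj0 => ?_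
        · simpa only [Expr.eval, h4', h5''] using hj0
        simp only [Expr.eval, h4', h5''] at hj0
        refine Runs.ite (fun hi0 => ?_) fun hi0 => .straight rfl (old fun _ h => absurd ?_ h)
        · simp only [Expr.eval, h5i, h5''] at hi0
          refine Runs.ite (fun hji => .straight rfl ?_) fun hji =>
            .straight rfl (old fun h => absurd h ?_)
          · refine ⟨⟨j, hj⟩, ⟨i, hi⟩, ?_, ?_, hj0, .inr ⟨?_, hi0⟩⟩
            · simp [State.setReg, Prog.run, Expr.eval, h4']
            · simp [State.setReg, Prog.run, Expr.eval, h5i]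
            · simpa only [Expr.eval, h4', h5i, ne_eq, hadj, not_not] using hji
          · simpa only [Expr.eval, h4', h5i, hadj] using hji
        · simpa only [Expr.eval, h5i, h5''] using hi0
      · intro s' _ h
        refine hP rfl rfl h fun u v hu _ _ => .inr ?_
        have := v.2
        lia
    · rintro s' - ⟨x, y, h6, h7, hx, h⟩
      refine ⟨x, y, h6, h7, hx, h.imp_left fun ⟨hxy, h⟩ => ⟨hxy, fun u v huv hu => ?_⟩⟩
      exact h v u v.2 huv.symm hu

/-- The forest after `t` rounds. -/
structure PartialForest (I : AMAPF) (t : ℕ) (vis par ord : ℕ → ℕ) : Prop where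
  exists_ord : ∀ j < t, ∃ x : Fin I.n, ord j = x ∧ vis x = j + 1
  vis_le : ∀ x : Fin I.n, vis x ≤ t
  ord_vis : ∀ x : Fin I.n, vis x ≠ 0 → ord (vis x - 1) = x
  par_spec : ∀ x : Fin I.n, vis x ≠ 0 →
    (par x = x ∧ ∀ u v, I.graph.Adj u v → vis u ≠ 0 → vis u < vis x → vis v ≠ 0 ∧ vis v < vis x) ∨
      ∃ y : Fin I.n, par x = y ∧ I.graph.Adj x y ∧ vis y ≠ 0 ∧ vis y < vis x

theorem PartialForest.exists_unvisited {t : ℕ} {vis par ord : ℕ → ℕ}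
    (h : PartialForest I t vis par ord) (ht : t < I.n) : ∃ x : Fin I.n, vis x = 0 := by
  by_contra! hne
  have hinj : Function.Injective fun x : Fin I.n =>
      (⟨vis x - 1, by have := h.vis_le x; have := hne x; lia⟩ : Fin t) := by
    intro x y hxy
    have := congrArg Fin.val hxy
    simp only at this
    ext
    rw [← h.ord_vis x (hne x), this, h.ord_vis y (hne y)]
  have := Fintype.card_le_of_injective _ hinj
  simp only [Fintype.card_fin] at this
  lia

/-- The new node gets a larger number than all earlier ones, so the conditions on those persist. It
becomes a root only if the discovered set is closed under adjacency, which is the condition required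
of roots. -/
theorem PartialForest.step {t : ℕ} {vis par ord : ℕ → ℕ} (h : PartialForest I t vis par ord)
    {x y : Fin I.n} (hx : vis x = 0)
    (hxy : (x = y ∧ ∀ u v, I.graph.Adj u v → vis u ≠ 0 → vis v ≠ 0) ∨
        (I.graph.Adj x y ∧ vis y ≠ 0)) :
    PartialForest I (t + 1) (Function.update vis x (t + 1)) (Function.update par x y)
      (Function.update ord t x) := by
  have hne : ∀ z : Fin I.n, vis z ≠ 0 → (z : ℕ) ≠ x := fun z hz e => hz (by rwa [e])
  refine ⟨fun j hj => ?_, fun z => ?_, fun z hz => ?_, fun z hz => ?_⟩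
  · rcases Nat.lt_succ_iff_lt_or_eq.1 hj with hj | rfl
    · obtain ⟨z, h₁, h₂⟩ := h.exists_ord j hj
      exact ⟨z, by rwa [Function.update_of_ne hj.ne],
        by rwa [Function.update_of_ne (hne z (by lia))]⟩
    · exact ⟨x, by simp, by simp⟩
  · have := h.vis_le z
    rw [Function.update_apply]
    split_ifs <;> lia
  · by_cases hzx : z = x
    · subst hzx
      simp
    · have hzx' : (z : ℕ) ≠ x := fun e => hzx (Fin.ext e)
      rw [Function.update_of_ne hzx'] at hz ⊢
      have := h.vis_le z
      rw [Function.update_of_ne (by lia)]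
      exact h.ord_vis z hz
  · by_cases hzx : z = x
    · subst hzx
      simp only [Function.update_self]
      rcases hxy with ⟨rfl, hxy⟩ | ⟨hxy, hy⟩
      · refine .inl ⟨rfl, fun u v huv hu hu' => ?_⟩
        have hu : (u : ℕ) ≠ z := by
          intro e
          rw [e, Function.update_self] at hu'
          exact hu'.false
        rw [Function.update_of_ne hu] at *
        have hv := hxy u v huv (by assumption)
        have := h.vis_le v
        rw [Function.update_of_ne (hne v hv)]
        lia
      · have := h.vis_le y
        exact .inr ⟨y, rfl, hxy, by rw [Function.update_of_ne (hne y hy)]; lia⟩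
    · have hzx' : (z : ℕ) ≠ x := fun e => hzx (Fin.ext e)
      rw [Function.update_of_ne hzx'] at hz
      rw [Function.update_of_ne hzx', Function.update_of_ne hzx']
      have hzt := h.vis_le z
      rcases h.par_spec z hz with ⟨hp, h'⟩ | ⟨y', hp, hadj, hy, hlt⟩
      · refine .inl ⟨hp, fun u v huv hu hu' => ?_⟩
        have hux : (u : ℕ) ≠ x := by
          intro e
          rw [e, Function.update_self] at hu'
          lia
        rw [Function.update_of_ne hux] at hu hu'
        have := h' u v huv hu hu'
        rwa [Function.update_of_ne (hne v this.1)]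
      · exact .inr ⟨y', hp, hadj, by rw [Function.update_of_ne (hne y' hy)]; exact ⟨hy, hlt⟩⟩

/-- The forest `F` is stored in the arrays 6 and 7. -/
structure StoresForest (F : RankedForest I.graph) (s : State) : Prop where
  par : ∀ x : Fin I.n, s.arr 6 x = F.par x
  ord : ∀ j < I.n, ∃ x : Fin I.n, s.arr 7 j = x ∧ F.rank x = j

theorem PartialForest.exists_storesForest
    (h : PartialForest I I.n (s.arr 5) (s.arr 6) (s.arr 7)) :
    ∃ F : RankedForest I.graph, StoresForest F s := by
  choose g hg hg' using fun j : Fin I.n => h.exists_ord j j.2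
  -- After `n` rounds the enumeration `g` is injective on a finite type, hence surjective: every
  -- node has been discovered.
  have hinj : Function.Injective g := by
    intro i j hij
    have hi := hg' i
    rw [hij, hg' j] at hi
    exact Fin.ext (by lia)
  have hvis : ∀ x : Fin I.n, s.arr 5 x ≠ 0 := by
    intro x
    obtain ⟨j, rfl⟩ := (Finite.injective_iff_surjective.1 hinj) x
    rw [hg' j]
    exact Nat.succ_ne_zero _
  have hpar : ∀ x : Fin I.n, ∃ y : Fin I.n, s.arr 6 x = y := by
    intro x
    rcases h.par_spec x (hvis x) with ⟨hx, -⟩ | ⟨y, hy, -⟩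
    · exact ⟨x, hx⟩
    · exact ⟨y, hy⟩
  choose p hp using hpar
  have hne : ∀ x, p x ≠ x → I.graph.Adj x (p x) ∧ s.arr 5 (p x) < s.arr 5 x := by
    intro x hx
    rcases h.par_spec x (hvis x) with ⟨hx', -⟩ | ⟨y, hy, hadj, -, hlt⟩
    · exact absurd (Fin.ext ((hp x).symm.trans hx')) hx
    · obtain rfl : p x = y := Fin.ext ((hp x).symm.trans hy)
      exact ⟨hadj, hlt⟩
  refine ⟨⟨p, fun x => s.arr 5 x - 1, fun x y hxy => ?_, fun x hx => (hne x hx).1, fun x hx => ?_,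
    fun x hx u v huv hu => ?_⟩, fun x => hp x, fun j hj => ⟨g ⟨j, hj⟩, hg ⟨j, hj⟩, ?_⟩⟩
  · simp only at hxy
    ext
    rw [← h.ord_vis x (hvis x), hxy, h.ord_vis y (hvis y)]
  · have := (hne x hx).2
    have := hvis (p x)
    lia
  · have hu0 := hvis u
    rcases h.par_spec x (hvis x) with ⟨-, hx'⟩ | ⟨y, hy, hadj, -⟩
    · have := hx' u v huv hu0 (by lia)
      lia
    · obtain rfl : x = y := hx.symm.trans (Fin.ext ((hp x).symm.trans hy))
      exact absurd hadj (SimpleGraph.irrefl _)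
  · simp [hg' ⟨j, hj⟩]

theorem runs_growForest (hs : Loaded I s) (hB : I.n ≤ B) (h5 : ∀ x, s.arr 5 x = 0) :
    Runs B growForest s fun s' => ∃ F : RankedForest I.graph, StoresForest F s' := by
  refine Runs.forLoop I.n (fun t s' => PartialForest I t (s'.arr 5) (s'.arr 6) (s'.arr 7)) rfl hB
    (fun s' hf => (hf.reg 0 rfl).trans hs.n) ?_ ?_ fun s' _ h => h.exists_storesForest
  · refine ⟨by simp, ?_, ?_, ?_⟩ <;> simp [State.setReg, h5]
  · intro t s₁ ht hf₁ h3 hinv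
    refine Runs.seq (runs_candidate (hs.frame hf₁ rfl) hB (hinv.exists_unvisited ht)) ?_
    rintro s₂ hf₂ ⟨x, y, h6, h7, hx, hxy⟩
    have h3' : s₂.reg 3 = t := (hf₂.reg 3 rfl).trans h3
    have e5 : s₂.arr 5 = s₁.arr 5 := hf₂.arr 5 rfl
    have e6 : s₂.arr 6 = s₁.arr 6 := hf₂.arr 6 rfl
    have e7 : s₂.arr 7 = s₁.arr 7 := hf₂.arr 7 rfl
    refine Runs.straight rfl ?_
    have := hinv.step hx hxy
    simpa [State.setReg, Prog.run, Expr.eval, h3', h6, h7, e5, e6, e7] using this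

/-- The array `o` contains `i + 1` at the position of agent `i`, and 0 at unoccupied nodes. -/
structure Occupancy (c : Fin I.k → Fin I.n) (o : ℕ → ℕ) : Prop where
  occupied : ∀ i, o (c i) = i + 1
  free : ∀ v : Fin I.n, (∀ i, c i ≠ v) → o v = 0

/-- The indicator of the range of `g`. -/
def indicator (g : Fin I.k → Fin I.n) (v : Fin I.n) : ℕ := if ∃ i, g i = v then 1 else 0

/-! ### The flow

Array 8 holds the occupancy, arrays 9 and 10 the numbers of agents and of goals in the subtrees. -/

/-- Enters the start nodes and the goals. -/
def placeTokens : Prog :=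
  forLoop 3 (.reg 1) (
    .store 8 (.cell 2 (.reg 3)) (.plus (.reg 3) (.lit 1)) ;;
    .store 9 (.cell 2 (.reg 3)) (.lit 1) ;;
    .store 10 (.cell 3 (.reg 3)) (.lit 1))

theorem update_indicator {g : Fin I.k → Fin I.n} {a : ℕ → ℕ} {j : ℕ} (hj : j < I.k)
    (h : ∀ v : Fin I.n, a v = if ∃ i : Fin I.k, (i : ℕ) < j ∧ g i = v then 1 else 0)
    (v : Fin I.n) : Function.update a (g ⟨j, hj⟩) 1 v =
      if ∃ i : Fin I.k, (i : ℕ) < j + 1 ∧ g i = v then 1 else 0 := by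
  by_cases hv : v = g ⟨j, hj⟩
  · subst hv
    rw [Function.update_self, if_pos ⟨⟨j, hj⟩, Nat.lt_succ_self j, rfl⟩]
  · rw [Function.update_of_ne (fun e => hv (Fin.ext e)), h v]
    congr 1
    refine propext ⟨fun ⟨i, hi, hiv⟩ => ⟨i, by lia, hiv⟩, fun ⟨i, hi, hiv⟩ => ⟨i, ?_, hiv⟩⟩
    rcases Nat.lt_succ_iff_lt_or_eq.1 hi with hi | hi
    · exact hi
    · obtain rfl : i = ⟨j, hj⟩ := Fin.ext hi
      exact absurd hiv.symm hv

theorem runs_placeTokens (hs : Loaded I s) (hB : I.k ≤ B)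
    (h8 : ∀ x, s.arr 8 x = 0) (h9 : ∀ x, s.arr 9 x = 0) (h10 : ∀ x, s.arr 10 x = 0) :
    Runs B placeTokens s fun s' => Occupancy I.start (s'.arr 8) ∧
      (∀ v : Fin I.n, s'.arr 9 v = indicator I.start v) ∧
      ∀ v : Fin I.n, s'.arr 10 v = indicator I.goal v := by
  refine Runs.forLoop I.k (fun j s' => (∀ i : Fin I.k, (i : ℕ) < j → s'.arr 8 (I.start i) = i + 1) ∧
      (∀ v : Fin I.n, (∀ i : Fin I.k, (i : ℕ) < j → I.start i ≠ v) → s'.arr 8 v = 0) ∧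
      (∀ v : Fin I.n, s'.arr 9 v = if ∃ i : Fin I.k, (i : ℕ) < j ∧ I.start i = v then 1 else 0) ∧
      ∀ v : Fin I.n, s'.arr 10 v = if ∃ i : Fin I.k, (i : ℕ) < j ∧ I.goal i = v then 1 else 0) rfl hB
    (fun s' hf => (hf.reg 1 rfl).trans hs.k) ?_ ?_ ?_
  · simp [State.setReg, h8, h9, h10]
  · rintro j s₁ hj hf h3 ⟨i8, i8', i9, i10⟩
    have hs₁ := hs.frame hf rfl
    have hst := hs₁.start ⟨j, hj⟩
    have hgo := hs₁.goal ⟨j, hj⟩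
    simp only at hst hgo
    refine Runs.straight rfl ?_
    refine ⟨fun i hi => ?_, fun v hv => ?_, fun v => ?_, fun v => ?_⟩
    · by_cases hij : i = ⟨j, hj⟩
      · subst hij
        simp [State.setReg, Prog.run, Expr.eval, h3, hst]
      · have : (I.start i : ℕ) ≠ I.start ⟨j, hj⟩ :=
          fun e => hij (I.start.injective (Fin.ext e))
        have hij' : (i : ℕ) ≠ j := fun e => hij (Fin.ext e)
        simpa [State.setReg, Prog.run, Expr.eval, h3, hst, this] using i8 i (by lia)
    · have h : (v : ℕ) ≠ I.start ⟨j, hj⟩ := fun e => hv ⟨j, hj⟩ (Nat.lt_succ_self j) (Fin.ext e.symm)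
      simpa [State.setReg, Prog.run, Expr.eval, h3, hst, h] using
        i8' v fun i hi => hv i (by lia)
    · simpa [State.setReg, Prog.run, Expr.eval, h3, hst] using update_indicator hj i9 v
    · simpa [State.setReg, Prog.run, Expr.eval, h3, hgo] using update_indicator hj i10 v
  · rintro s' - ⟨i8, i8', i9, i10⟩
    refine ⟨⟨fun i => i8 i i.2, fun v hv => i8' v fun i _ => hv i⟩, fun v => ?_, fun v => ?_⟩
    · simp [i9 v, indicator]
    · simp [i10 v, indicator]

/-- Sums up the numbers of agents and of goals in the subtrees. -/
def sumSubtrees : Prog :=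
  forLoop 3 (.reg 0) (
    .assign 4 (.cell 7 (.minus (.reg 0) (.plus (.reg 3) (.lit 1)))) ;;
    .assign 5 (.cell 6 (.reg 4)) ;;
    .ite (neExpr (.reg 4) (.reg 5)) (
      .store 9 (.reg 5) (.plus (.cell 9 (.reg 5)) (.cell 9 (.reg 4))) ;;
      .store 10 (.reg 5) (.plus (.cell 10 (.reg 5)) (.cell 10 (.reg 4))))
    .skip)

/-- The sums after the last `j` nodes have been added to their parents. -/
def PartialSum (F : RankedForest I.graph) (d : Fin I.n → ℕ) (j : ℕ) (a : ℕ → ℕ) : Prop :=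
  ∀ x : Fin I.n, a x = d x + ∑ y ∈ F.children x with I.n - j ≤ F.rank y, a y

/-- Nodes are processed by decreasing rank, so `a x` is final when it is added to the parent. The
parent has smaller rank than `x`, so its changed entry is not a summand in any of the sums. -/
theorem PartialSum.step {F : RankedForest I.graph} {d : Fin I.n → ℕ} {j : ℕ} {a : ℕ → ℕ}
    (h : PartialSum F d j a) (hj : j < I.n) {x : Fin I.n} (hx : F.rank x = I.n - (j + 1)) :
    PartialSum F d (j + 1)
      (if F.par x = x then a else Function.update a (F.par x) (a (F.par x) + a x)) := by
  have hsum : ∀ z, ∑ y ∈ F.children z with I.n - (j + 1) ≤ F.rank y, a y =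
      ∑ y ∈ F.children z with I.n - j ≤ F.rank y, a y + if x ∈ F.children z then a x else 0 := by
    intro z
    rw [Finset.sum_filter, Finset.sum_filter,
      ← Finset.sum_ite_eq' (F.children z) x fun y => a y, ← Finset.sum_add_distrib]
    refine Finset.sum_congr rfl fun y _ => ?_
    by_cases hyx : y = x
    · subst hyx
      rw [if_pos hx.ge, if_neg (by lia), if_pos rfl, zero_add]
    · have : F.rank y ≠ F.rank x := fun e => hyx (F.rank_injective e)
      rw [if_neg hyx, add_zero]
      congr 1
      refine propext ?_
      lia
  intro z
  by_cases hpx : F.par x = x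
  · simp only [if_pos hpx]
    rw [hsum, if_neg (by simp [RankedForest.children, hpx]), add_zero, h z]
  · simp only [if_neg hpx]
    have hlt := F.rank_par_lt x hpx
    have e : ∑ y ∈ F.children z with I.n - (j + 1) ≤ F.rank y,
        Function.update a (F.par x) (a (F.par x) + a x) y =
        ∑ y ∈ F.children z with I.n - (j + 1) ≤ F.rank y, a y := by
      refine Finset.sum_congr rfl fun y hy => ?_
      rw [Finset.mem_filter] at hy
      refine Function.update_of_ne (fun e => ?_) _ _
      obtain rfl : y = F.par x := Fin.ext e
      lia
    rw [e, hsum]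
    by_cases hz : z = F.par x
    · subst hz
      rw [Function.update_self, if_pos (by simp [RankedForest.children, hpx]), ← add_assoc, ← h]
    · rw [Function.update_of_ne (fun e => hz (Fin.ext e)),
        if_neg (by simp [RankedForest.children, Ne.symm hz]), add_zero, h z]

theorem runs_sumSubtrees (hs : Loaded I s) (hB : I.n ≤ B) {F : RankedForest I.graph}
    (hF : StoresForest F s) {d₁ d₂ : Fin I.n → ℕ}
    (h9 : ∀ v : Fin I.n, s.arr 9 v = d₁ v) (h10 : ∀ v : Fin I.n, s.arr 10 v = d₂ v) :
    Runs B sumSubtrees s fun s' =>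
      (∀ x : Fin I.n, s'.arr 9 x = d₁ x + ∑ y ∈ F.children x, s'.arr 9 y) ∧
      ∀ x : Fin I.n, s'.arr 10 x = d₂ x + ∑ y ∈ F.children x, s'.arr 10 y := by
  have hrank : ∀ x, F.rank x < I.n := by
    intro x
    choose g hg hg' using fun j : Fin I.n => hF.ord j j.2
    have hinj : Function.Injective g := by
      intro i j hij
      have hi := hg' i
      rw [hij, hg' j] at hi
      exact Fin.ext hi.symm
    obtain ⟨j, rfl⟩ := (Finite.injective_iff_surjective.1 hinj) x
    rw [hg' j]
    exact j.2
  refine Runs.forLoop I.n (fun j s' => PartialSum F d₁ j (s'.arr 9) ∧ PartialSum F d₂ j (s'.arr 10))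
    rfl hB (fun s' hf => (hf.reg 0 rfl).trans hs.n) ?_ ?_ ?_
  · have : ∀ z, (F.children z).filter (fun y => I.n - 0 ≤ F.rank y) = ∅ := by
      intro z
      refine Finset.filter_eq_empty_iff.2 fun y _ => ?_
      have := hrank y
      lia
    constructor <;> intro z <;> rw [this, Finset.sum_empty, add_zero]
    · exact h9 z
    · exact h10 z
  · rintro j s₁ hj hf h3 ⟨i9, i10⟩
    have h0 : s₁.reg 0 = I.n := (hf.reg 0 rfl).trans hs.n
    obtain ⟨x, h7, hx⟩ := hF.ord (I.n - (j + 1)) (by lia)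
    rw [← hf.arr 7 rfl] at h7
    have h6 : s₁.arr 6 x = F.par x := by rw [hf.arr 6 rfl, hF.par]
    have j9 := i9.step hj hx
    have j10 := i10.step hj hx
    refine Runs.straight rfl ?_
    by_cases hpx : F.par x = x
    · rw [if_pos hpx] at j9 j10
      simpa [State.setReg, Prog.run, Expr.eval, h0, h3, h7, h6, hpx] using And.intro j9 j10
    · rw [if_neg hpx] at j9 j10
      have hpx' : ¬ x = F.par x := fun e => hpx e.symm
      simpa [State.setReg, Prog.run, Expr.eval, h0, h3, h7, h6, Fin.val_inj, hpx'] using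
        And.intro j9 j10
  · rintro s' - ⟨i9, i10⟩
    constructor
    · intro x
      rw [i9 x]
      simp
    · intro x
      rw [i10 x]
      simp

/-- Finds out whether some component has different numbers of agents and of goals. -/
def checkRoots : Prog :=
  .assign 8 (.lit 0) ;;
  forLoop 3 (.reg 0) (.ite (neExpr (.reg 3) (.cell 6 (.reg 3))) .skip
    (.ite (neExpr (.cell 9 (.reg 3)) (.cell 10 (.reg 3))) (.assign 8 (.lit 1)) .skip))

theorem runs_checkRoots (hs : Loaded I s) (hB : I.n ≤ B) {F : RankedForest I.graph}
    (hF : StoresForest F s) :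
    Runs B checkRoots s fun s' =>
      s'.reg 8 = 0 ↔ ∀ x : Fin I.n, F.par x = x → s.arr 9 x = s.arr 10 x := by
  refine Runs.seq (R := fun s' => s'.reg 8 = 0) (.straight rfl rfl) fun s₁ hf₁ h8 => ?_
  have hs₁ := hs.frame hf₁ rfl
  refine Runs.forLoop I.n (fun j s' => s'.reg 8 = 0 ↔
    ∀ x : Fin I.n, (x : ℕ) < j → F.par x = x → s.arr 9 x = s.arr 10 x) rfl hB
    (fun s' hf => (hf.reg 0 rfl).trans hs₁.n) ?_ ?_ ?_
  · simp [State.setReg, h8]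
  · intro j s₂ hj hf₂ h3 hinv
    have h6 : s₂.arr 6 j = F.par ⟨j, hj⟩ := by
      rw [hf₂.arr 6 rfl, hf₁.arr 6 rfl]
      exact hF.par ⟨j, hj⟩
    have e9 : s₂.arr 9 = s.arr 9 := (hf₂.arr 9 rfl).trans (hf₁.arr 9 rfl)
    have e10 : s₂.arr 10 = s.arr 10 := (hf₂.arr 10 rfl).trans (hf₁.arr 10 rfl)
    have split : (∀ x : Fin I.n, (x : ℕ) < j + 1 → F.par x = x → s.arr 9 x = s.arr 10 x) ↔
        (∀ x : Fin I.n, (x : ℕ) < j → F.par x = x → s.arr 9 x = s.arr 10 x) ∧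
          (F.par ⟨j, hj⟩ = ⟨j, hj⟩ → s.arr 9 j = s.arr 10 j) := by
      refine ⟨fun h => ⟨fun x hx => h x (by lia), h ⟨j, hj⟩ (Nat.lt_succ_self j)⟩,
        fun h x hx => ?_⟩
      rcases Nat.lt_succ_iff_lt_or_eq.1 hx with hx | hx
      · exact h.1 x hx
      · obtain rfl : x = ⟨j, hj⟩ := Fin.ext hx
        exact h.2
    have hpar : j = (F.par ⟨j, hj⟩ : ℕ) ↔ F.par ⟨j, hj⟩ = ⟨j, hj⟩ :=
      ⟨fun e => Fin.ext e.symm, fun e => by rw [e]⟩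
    rw [split]
    refine Runs.ite (fun h => .straight rfl ?_) fun h => ?_
    · rw [Ne, neExpr_eval] at h
      simp only [Expr.eval, h3, h6, hpar] at h
      simpa [State.setReg, Prog.run, h] using hinv
    · rw [neExpr_eval] at h
      simp only [Expr.eval, h3, h6, hpar] at h
      refine Runs.ite (fun h' => .straight rfl ?_) fun h' => .straight rfl ?_
      · rw [Ne, neExpr_eval] at h'
        simp only [Expr.eval, h3, e9, e10] at h'
        simp [State.setReg, Prog.run, Expr.eval, h, h']
      · rw [neExpr_eval] at h'
        simp only [Expr.eval, h3, e9, e10] at h'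
        simpa [State.setReg, Prog.run, h'] using hinv
  · intro s' _ h
    rw [h]
    exact ⟨fun h x => h x x.2, fun h x _ => h x⟩

/-! ### Moving the agents

Register 9 holds the number of moves made so far, and the arrays 11, 12 and 13 the agents (plus
one), the new nodes and the durations of these moves. -/

/-- Moves the agent at the node in register 6 to the node in register 7, along the edge from the
node in register 4 to its parent. -/
def move : Prog :=
  .store 11 (.reg 9) (.cell 8 (.reg 6)) ;;
  .store 12 (.reg 9) (.reg 7) ;;
  .store 13 (.reg 9) (.cell 1 (.plus (.cell 4 (.reg 6)) (.reg 7))) ;;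
  .assign 9 (.plus (.reg 9) (.lit 1)) ;;
  .store 8 (.reg 7) (.cell 8 (.reg 6)) ;;
  .store 8 (.reg 6) (.lit 0) ;;
  .ite (.minus (.cell 9 (.reg 4)) (.cell 10 (.reg 4)))
    (.store 9 (.reg 4) (.minus (.cell 9 (.reg 4)) (.lit 1)))
    (.store 9 (.reg 4) (.plus (.cell 9 (.reg 4)) (.lit 1)))

/-- Puts the ends of the edge from the node in register 4 to its parent into the registers 6 and
7, in the direction of the flow. -/
def orient : Prog :=
  .assign 5 (.cell 6 (.reg 4)) ;;
  .ite (.minus (.cell 9 (.reg 4)) (.cell 10 (.reg 4)))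
    (.assign 6 (.reg 4) ;; .assign 7 (.reg 5)) (.assign 6 (.reg 5) ;; .assign 7 (.reg 4))

/-- Moves an agent along the edge from the node in register 4 to its parent if the flow demands
it and the target is unoccupied. -/
def tryMove : Prog :=
  orient ;;
  .ite (neExpr (.cell 9 (.reg 4)) (.cell 10 (.reg 4)))
    (.ite (.cell 8 (.reg 6)) (.ite (.cell 8 (.reg 7)) .skip move) .skip) .skip

/-- Tries all edges of the forest `n * n + 1` times. -/
def makeMoves : Prog :=
  forLoop 3 (.plus (.reg 2) (.lit 1)) (forLoop 4 (.reg 0) tryMove)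

/-- The flow that is still to be sent from a node to its parent. -/
def flow (I : AMAPF) (s : State) (x : Fin I.n) : ℤ := (s.arr 9 x : ℤ) - s.arr 10 x

/-- The moves `l` have been made; they have led to the positions `c`. -/
structure Moved (F : RankedForest I.graph) (s : State) (l : List I.Move) (c : Fin I.k → Fin I.n) :
    Prop where
  leads : I.Leads l c
  occupancy : Occupancy c (s.arr 8)
  length : s.reg 9 = l.length
  log : ∀ j (h : j < l.length),
    s.arr 11 j = l[j].1 + 1 ∧ s.arr 12 j = l[j].2.1 ∧ s.arr 13 j = l[j].2.2
  flow_eq : ∀ x, flow I s x = ((indicator c x : ℤ) - indicator I.goal x) +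
    ∑ y ∈ F.children x, flow I s y
  root : ∀ x, F.par x = x → flow I s x = 0
  potential : l.length + ∑ x, (flow I s x).natAbs ≤ I.n * I.n

variable {F : RankedForest I.graph} {l : List I.Move} {c : Fin I.k → Fin I.n}

theorem Moved.congr (h : Moved F s l c) {s' : State} (h9 : s'.reg 9 = s.reg 9)
    (ha : s'.arr = s.arr) : Moved F s' l c := by
  have hf : flow I s' = flow I s := by
    funext x
    rw [flow, flow, ha]
  exact ⟨h.leads, by rw [ha]; exact h.occupancy, h9.trans h.length, by rw [ha]; exact h.log,
    by rw [hf]; exact h.flow_eq, by rw [hf]; exact h.root, by rw [hf]; exact h.potential⟩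

theorem indicator_update (hc : Function.Injective c) (i : Fin I.k) {v : Fin I.n}
    (hv : ∀ i, c i ≠ v) (z : Fin I.n) :
    (indicator (Function.update c i v) z : ℤ) =
      indicator c z + (if z = v then 1 else 0) - (if z = c i then 1 else 0) := by
  have h : (∃ j, Function.update c i v j = z) ↔ z = v ∨ ((∃ j, c j = z) ∧ z ≠ c i) := by
    constructor
    · rintro ⟨j, rfl⟩
      by_cases hj : j = i
      · subst hj
        exact .inl (Function.update_self ..)
      · rw [Function.update_of_ne hj]
        exact .inr ⟨⟨j, rfl⟩, fun e => hj (hc e)⟩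
    · rintro (rfl | ⟨⟨j, rfl⟩, hj⟩)
      · exact ⟨i, Function.update_self ..⟩
      · exact ⟨j, Function.update_of_ne (fun e => hj (by rw [e])) ..⟩
  have h₁ : z = v → ¬ ∃ j, c j = z := fun e ⟨j, hj⟩ => hv j (hj.trans e)
  have h₂ : z = c i → ∃ j, c j = z := fun e => ⟨i, e.symm⟩
  simp only [indicator, h]
  by_cases hz : z = v
  · rw [if_pos (.inl hz), if_neg (h₁ hz), if_pos hz, if_neg fun e => h₁ hz (h₂ e)]
    simp
  · by_cases hz' : z = c i
    · simp [h₂ hz', hz, if_pos hz']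
    · simp [hz, hz']

theorem Occupancy.update {o : ℕ → ℕ} (h : Occupancy c o) (hc : Function.Injective c) (i : Fin I.k)
    {v : Fin I.n} (hv : ∀ i, c i ≠ v) :
    Occupancy (Function.update c i v)
      (Function.update (Function.update o v (i + 1)) (c i) 0) := by
  constructor
  · intro j
    by_cases hj : j = i
    · subst hj
      rw [Function.update_self, Function.update_of_ne (fun e => hv j (Fin.ext e.symm)),
        Function.update_self]
    · rw [Function.update_of_ne hj, Function.update_of_ne (fun e => hj (hc (Fin.ext e))),
        Function.update_of_ne (fun e => hv j (Fin.ext e)), h.occupied]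
  · intro w hw
    by_cases hwi : w = c i
    · subst hwi
      exact Function.update_self ..
    · have hwv : w ≠ v := by
        rintro rfl
        exact hw i (Function.update_self ..)
      rw [Function.update_of_ne (fun e => hwi (Fin.ext e)),
        Function.update_of_ne (fun e => hwv (Fin.ext e))]
      refine h.free w fun j hj => ?_
      refine hw j ?_
      rw [Function.update_of_ne, hj]
      rintro rfl
      exact hwi hj.symm

/-- The sign `δ` moves the flow at `x` towards zero, so the sum of absolute flows pays for the new
move and `potential` is kept. The same change of flow balances the shift of the agent from one end
of the edge to the other. -/
theorem Moved.snoc (h : Moved F s l c) {s' : State} {x v : Fin I.n} {i : Fin I.k} {δ : ℤ}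
    (hx : F.par x ≠ x) (hv : ∀ i, c i ≠ v)
    (hdir : (0 < flow I s x ∧ c i = x ∧ v = F.par x ∧ δ = -1) ∨
      (flow I s x < 0 ∧ c i = F.par x ∧ v = x ∧ δ = 1))
    (h8 : s'.arr 8 = Function.update (Function.update (s.arr 8) v (i + 1)) (c i) 0)
    (hf : flow I s' = Function.update (flow I s) x (flow I s x + δ))
    (h9 : s'.reg 9 = s.reg 9 + 1)
    (h11 : s'.arr 11 = Function.update (s.arr 11) (s.reg 9) (i + 1))
    (h12 : s'.arr 12 = Function.update (s.arr 12) (s.reg 9) v)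
    (h13 : s'.arr 13 = Function.update (s.arr 13) (s.reg 9) (I.weight (c i) v)) :
    Moved F s' (l ++ [(i, v, I.weight (c i) v)]) (Function.update c i v) := by
  have hadj : I.graph.Adj (c i) v := by
    rcases hdir with ⟨-, h₁, h₂, -⟩ | ⟨-, h₁, h₂, -⟩
    · rw [h₁, h₂]
      exact F.adj_par x hx
    · rw [h₁, h₂]
      exact (F.adj_par x hx).symm
  refine ⟨h.leads.snoc i v hadj hv, ?_, by simp [h9, h.length], fun j hj => ?_, ?_, fun y hy => ?_,
    ?_⟩
  · rw [h8]
    exact h.occupancy.update h.leads.injective i hv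
  · rw [h11, h12, h13, h.length]
    by_cases hjl : j < l.length
    · rw [Function.update_of_ne hjl.ne, Function.update_of_ne hjl.ne, Function.update_of_ne hjl.ne,
        List.getElem_append_left hjl]
      exact h.log j hjl
    · have : j = l.length := by
        simp only [List.length_append, List.length_singleton] at hj
        lia
      subst this
      simp
  · rw [hf]
    refine F.conservation_update h.flow_eq hx fun z => ?_
    rw [indicator_update h.leads.injective i hv]
    rcases hdir with ⟨-, h₁, h₂, h₃⟩ | ⟨-, h₁, h₂, h₃⟩
    · rw [h₁, h₂, h₃]
      split_ifs <;> ring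
    · rw [h₁, h₂, h₃]
      ring
  · rw [hf, Function.update_of_ne (by rintro rfl; exact hx hy), h.root y hy]
  · have hp := h.potential
    rw [← Finset.add_sum_erase _ _ (Finset.mem_univ x)] at hp ⊢
    have : ∑ y ∈ Finset.univ.erase x, (flow I s' y).natAbs =
        ∑ y ∈ Finset.univ.erase x, (flow I s y).natAbs := by
      refine Finset.sum_congr rfl fun y hy => ?_
      rw [hf, Function.update_of_ne (Finset.ne_of_mem_erase hy)]
    rw [this, hf, Function.update_self, List.length_append, List.length_singleton]
    lia

/-- No agent can move along the edge from `x` to its parent in the direction of the flow. -/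
def Blocked (F : RankedForest I.graph) (s : State) (x : Fin I.n) : Prop :=
  (0 < flow I s x → s.arr 8 x ≠ 0 → s.arr 8 (F.par x) ≠ 0) ∧
    (flow I s x < 0 → s.arr 8 (F.par x) ≠ 0 → s.arr 8 x ≠ 0)

theorem runs_move (hs : Loaded I s) (h : Moved F s l c) {x u v : Fin I.n}
    (hdir : (0 < flow I s x ∧ u = x ∧ v = F.par x) ∨ (flow I s x < 0 ∧ u = F.par x ∧ v = x))
    (h4 : s.reg 4 = x) (h6 : s.reg 6 = u) (h7 : s.reg 7 = v)
    (hu : s.arr 8 u ≠ 0) (hv : s.arr 8 v = 0) :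
    Runs B move s fun s' => ∃ l' c', Moved F s' l' c' ∧ l.length < l'.length := by
  have hx : F.par x ≠ x := by
    intro e
    have := h.root x e
    lia
  obtain ⟨i, rfl⟩ : ∃ i, c i = u := by
    by_contra! hne
    exact hu (h.occupancy.free u hne)
  have hv' : ∀ i, c i ≠ v := by
    rintro j rfl
    rw [h.occupancy.occupied] at hv
    exact Nat.succ_ne_zero _ hv
  have hadj : I.graph.Adj (c i) v := by
    rcases hdir with ⟨-, h₁, h₂⟩ | ⟨-, h₁, h₂⟩
    · rw [h₁, h₂]
      exact F.adj_par x hx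
    · rw [h₁, h₂]
      exact (F.adj_par x hx).symm
  have hw := hs.weight _ _ hadj
  have ho := h.occupancy.occupied i
  have hvi : ((c i : Fin I.n) : ℕ) ≠ v := fun e => hv' i (Fin.ext e)
  refine Runs.straight rfl ⟨l ++ [(i, v, I.weight (c i) v)], Function.update c i v, ?_, by simp⟩
  -- The truncated difference vanishes exactly if the flow is not positive, so this test determines
  -- the direction.
  by_cases hup : s.arr 9 x - s.arr 10 x = 0
  · have hneg : flow I s x < 0 ∧ c i = F.par x ∧ v = x := by
      rcases hdir with ⟨h₁, -⟩ | h
      · rw [flow] at h₁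
        lia
      · exact h
    refine h.snoc hx hv' (δ := 1) (.inr ⟨hneg.1, hneg.2.1, hneg.2.2, rfl⟩) ?_ ?_ ?_ ?_ ?_ ?_
    · simp [move, Prog.run, Expr.eval, h4, h6, h7, hup, ho]
    · funext y
      simp only [flow, move, Prog.run, Expr.eval, Function.update_apply]
      simp [h4, hup]
      by_cases hy : y = x
      · subst hy
        simp
        ring
      · simp [hy, Fin.val_inj]
    · simp [move, Prog.run, Expr.eval, h4, hup]
    · simp [move, Prog.run, Expr.eval, h4, h6, hup, ho]
    · simp [move, Prog.run, Expr.eval, h4, h7, hup]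
    · simp [move, Prog.run, Expr.eval, h4, h6, h7, hup, hw]
  · have hpos : 0 < flow I s x ∧ c i = x ∧ v = F.par x := by
      rcases hdir with h | ⟨h₁, -⟩
      · exact h
      · rw [flow] at h₁
        lia
    refine h.snoc hx hv' (δ := -1) (.inl ⟨hpos.1, hpos.2.1, hpos.2.2, rfl⟩) ?_ ?_ ?_ ?_ ?_ ?_
    · simp [move, Prog.run, Expr.eval, h4, h6, h7, hup, ho]
    · funext y
      simp only [flow, move, Prog.run, Expr.eval, Function.update_apply]
      simp [h4, hup]
      by_cases hy : y = x
      · subst hy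
        simp
        lia
      · simp [hy, Fin.val_inj]
    · simp [move, Prog.run, Expr.eval, h4, hup]
    · simp [move, Prog.run, Expr.eval, h4, h6, hup, ho]
    · simp [move, Prog.run, Expr.eval, h4, h7, hup]
    · simp [move, Prog.run, Expr.eval, h4, h6, h7, hup, hw]

theorem runs_orient (hF : StoresForest F s) {x : Fin I.n} (h4 : s.reg 4 = x) :
    Runs B orient s fun s' =>
      (0 < flow I s x → s'.reg 6 = x ∧ s'.reg 7 = F.par x) ∧
      (flow I s x < 0 → s'.reg 6 = F.par x ∧ s'.reg 7 = x) := by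
  refine Runs.straight rfl ?_
  have h6 := hF.par x
  by_cases hup : s.arr 9 x - s.arr 10 x = 0
  · refine ⟨fun h => ?_, fun _ => ?_⟩
    · rw [flow] at h
      lia
    · simp [orient, Prog.run, Expr.eval, h4, h6, hup]
  · refine ⟨fun _ => ?_, fun h => ?_⟩
    · simp [orient, Prog.run, Expr.eval, h4, h6, hup]
    · rw [flow] at h
      lia

/-- In the blocked case the arrays are untouched, so whatever is known about other blocked edges
stays valid. -/
theorem runs_tryMove (hs : Loaded I s) (hF : StoresForest F s) (h : Moved F s l c) {x : Fin I.n}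
    (h4 : s.reg 4 = x) :
    Runs B tryMove s fun s' => (Blocked F s x ∧ s'.arr = s.arr ∧ Moved F s' l c) ∨
      (¬ Blocked F s x ∧ ∃ l' c', Moved F s' l' c' ∧ l.length < l'.length) := by
  refine Runs.seq (runs_orient hF h4) fun s₁ hf₁ ⟨hpos, hneg⟩ => ?_
  have ha : s₁.arr = s.arr := funext fun a => hf₁.arr a rfl
  have h9 : s₁.reg 9 = s.reg 9 := hf₁.reg 9 rfl
  have h4' : s₁.reg 4 = x := (hf₁.reg 4 rfl).trans h4
  have h₁ := h.congr h9 ha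
  have hs₁ := hs.frame hf₁ rfl
  have hflow : flow I s₁ x = flow I s x := by rw [flow, flow, ha]
  have skip : Blocked F s x → Runs B .skip s₁ fun s' =>
      (Blocked F s x ∧ s'.arr = s.arr ∧ Moved F s' l c) ∨
      (¬ Blocked F s x ∧ ∃ l' c', Moved F s' l' c' ∧ l.length < l'.length) :=
    fun hb => .straight rfl (.inl ⟨hb, ha, h₁⟩)
  have core : ∀ u v : Fin I.n, s₁.reg 6 = u → s₁.reg 7 = v →
      ((0 < flow I s x ∧ u = x ∧ v = F.par x) ∨ (flow I s x < 0 ∧ u = F.par x ∧ v = x)) →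
      (Blocked F s x ↔ (s.arr 8 u ≠ 0 → s.arr 8 v ≠ 0)) →
      Runs B (.ite (.cell 8 (.reg 6)) (.ite (.cell 8 (.reg 7)) .skip move) .skip) s₁ fun s' =>
        (Blocked F s x ∧ s'.arr = s.arr ∧ Moved F s' l c) ∨
        (¬ Blocked F s x ∧ ∃ l' c', Moved F s' l' c' ∧ l.length < l'.length) := by
    intro u v h6 h7 hdir hb
    refine Runs.ite (fun hu => ?_) fun hu => skip (hb.2 fun hu' => absurd ?_ hu')
    · refine Runs.ite (fun hv => skip (hb.2 fun _ => ?_)) fun hv => ?_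
      · simpa only [Expr.eval, h7, ha] using hv
      · simp only [Expr.eval, h6, h7] at hu hv
        refine (runs_move hs₁ h₁ (by rwa [hflow]) h4' h6 h7 hu hv).mono fun s' _ hs' => .inr ⟨?_, hs'⟩
        rw [hb, ← ha]
        exact fun h => h hu hv
    · simpa only [Expr.eval, h6, ha] using hu
  refine Runs.ite (fun hne => ?_) fun heq => skip ?_
  · rw [Ne, neExpr_eval] at hne
    simp only [Expr.eval, h4', ha] at hne
    obtain hlt | hlt : flow I s x < 0 ∨ 0 < flow I s x := by
      rw [flow]
      lia
    · obtain ⟨h6, h7⟩ := hneg hlt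
      exact core _ _ h6 h7 (.inr ⟨hlt, rfl, rfl⟩)
        ⟨fun h => h.2 hlt, fun h => ⟨fun h' => absurd h' hlt.asymm, fun _ => h⟩⟩
    · obtain ⟨h6, h7⟩ := hpos hlt
      exact core _ _ h6 h7 (.inl ⟨hlt, rfl, rfl⟩)
        ⟨fun h => h.1 hlt, fun h => ⟨fun _ => h, fun h' => absurd h' hlt.asymm⟩⟩
  · rw [neExpr_eval] at heq
    simp only [Expr.eval, h4', ha] at heq
    have : flow I s x = 0 := by
      rw [flow]
      lia
    simp [Blocked, this]

theorem blocked_congr {s' : State} (ha : s'.arr = s.arr) : Blocked F s' = Blocked F s := by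
  funext x
  simp only [Blocked, flow, ha]

/-- A pass without a move leaves the arrays unchanged, so every edge it found blocked is still
blocked at its end. The last clause makes the stuck situation persist through all further passes. -/
theorem runs_pass (hs : Loaded I s) (hB : I.n ≤ B) (hF : StoresForest F s) (h : Moved F s l c) :
    Runs B (forLoop 4 (.reg 0) tryMove) s fun s' => ∃ l' c', Moved F s' l' c' ∧
      l.length ≤ l'.length ∧ (l.length < l'.length ∨ ∀ x, Blocked F s' x) ∧
      ((∀ x, Blocked F s x) → ∀ x, Blocked F s' x) := by
  refine Runs.forLoop I.n (fun j s' => ∃ l' c', Moved F s' l' c' ∧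
      l.length ≤ l'.length ∧ (l.length < l'.length ∨ ∀ x : Fin I.n, (x : ℕ) < j → Blocked F s' x) ∧
      ((∀ x, Blocked F s x) → ∀ x, Blocked F s' x)) rfl hB
      (fun s' hf => (hf.reg 0 rfl).trans hs.n) ?_ ?_ ?_
  · exact ⟨l, c, h.congr rfl rfl, le_rfl, .inr (by simp), fun h => h⟩
  · rintro j s₁ hj hf h4 ⟨l', c', h', hle, hor, himp⟩
    have hF₁ : StoresForest F s₁ := ⟨by rw [hf.arr 6 rfl]; exact hF.par,
      by rw [hf.arr 7 rfl]; exact hF.ord⟩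
    refine (runs_tryMove (hs.frame hf rfl) hF₁ h' (x := ⟨j, hj⟩) h4).mono ?_
    rintro s₂ - (⟨hb, ha, hm⟩ | ⟨hb, l'', c'', hm, hlt⟩)
    · have e : Blocked F (s₂.setReg 4 (j + 1)) = Blocked F s₁ := blocked_congr ha
      refine ⟨l', c', hm.congr rfl rfl, hle, hor.imp_right fun hall x hx => ?_, fun h0 => ?_⟩
      · rw [e]
        rcases Nat.lt_succ_iff_lt_or_eq.1 hx with hx | hx
        · exact hall x hx
        · obtain rfl : x = ⟨j, hj⟩ := Fin.ext hx
          exact hb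
      · rw [e]
        exact himp h0
    · exact ⟨l'', c'', hm.congr rfl rfl, by lia, .inl (by lia), fun h0 => absurd (himp h0 _) hb⟩
  · rintro s' - ⟨l', c', h', hle, hor, himp⟩
    exact ⟨l', c', h', hle, hor.imp_right fun h x => h x x.2, himp⟩

theorem Moved.range_eq (h : Moved F s l c) (hb : ∀ x, Blocked F s x) :
    Set.range c = Set.range I.goal := by
  have hmem : ∀ v : Fin I.n, v ∈ Finset.univ.image c ↔ s.arr 8 v ≠ 0 := by
    intro v
    simp only [Finset.mem_image, Finset.mem_univ, true_and]
    constructor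
    · rintro ⟨i, rfl⟩
      rw [h.occupancy.occupied]
      exact Nat.succ_ne_zero _
    · intro hv
      by_contra! hne
      exact hv (h.occupancy.free v hne)
  have := F.eq_of_stuck (f := flow I s) (S := Finset.univ.image c) (T := Finset.univ.image I.goal)
    (by rw [Finset.card_image_of_injective _ h.leads.injective,
      Finset.card_image_of_injective _ I.goal.injective])
    (fun x => by simpa [indicator] using h.flow_eq x) h.root
    (fun x hx hxs => by rw [hmem] at hxs ⊢; exact (hb x).1 hx hxs)
    (fun x hx hxs => by rw [hmem] at hxs ⊢; exact (hb x).2 hx hxs)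
  simpa using congrArg (fun S : Finset (Fin I.n) => (S : Set (Fin I.n))) this

/-- If each of the `n * n + 1` passes made a move, there would be more moves than `potential`
permits; hence some pass gets stuck. -/
theorem runs_makeMoves (hs : Loaded I s) (hB : I.n ≤ B) (hB' : I.n * I.n + 1 ≤ B)
    (hF : StoresForest F s) (h : Moved F s l c) :
    Runs B makeMoves s fun s' => ∃ l' c', Moved F s' l' c' ∧ Set.range c' = Set.range I.goal := by
  refine Runs.forLoop (I.n * I.n + 1) (fun j s' => ∃ l' c', Moved F s' l' c' ∧
    (j ≤ l'.length ∨ ∀ x, Blocked F s' x)) rfl hB' ?_ ?_ ?_ ?_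
  · intro s' hf
    simp only [Expr.eval, hf.reg 2 rfl, hs.sq]
  · exact ⟨l, c, h.congr rfl rfl, .inl (Nat.zero_le _)⟩
  · rintro j s₁ - hf - ⟨l', c', h', hor⟩
    have hF₁ : StoresForest F s₁ := ⟨by rw [hf.arr 6 rfl]; exact hF.par,
      by rw [hf.arr 7 rfl]; exact hF.ord⟩
    refine (runs_pass (hs.frame hf rfl) hB hF₁ h').mono ?_
    rintro s₂ - ⟨l'', c'', hm, -, hlt, himp⟩
    refine ⟨l'', c'', hm.congr rfl rfl, ?_⟩
    rcases hor with hor | hor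
    · rcases hlt with hlt | hlt
      · exact .inl (by lia)
      · exact .inr hlt
    · exact .inr (himp hor)
  · rintro s' - ⟨l', c', h', hor⟩
    refine ⟨l', c', h', h'.range_eq ?_⟩
    rcases hor with hor | hor
    · have := h'.potential
      lia
    · exact hor

/-! ### The output -/

/-- Replays the moves for the agent in register 3. -/
def writeRoute : Prog :=
  .assign 6 (.cell 2 (.reg 3)) ;;
  .emit (.plus (.reg 6) (.lit 1)) ;;
  forLoop 4 (.reg 9) (
    .ite (neExpr (.cell 11 (.reg 4)) (.plus (.reg 3) (.lit 1)))
      (forLoop 5 (.cell 13 (.reg 4)) (.emit (.plus (.reg 6) (.lit 1))))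
      (.assign 6 (.cell 12 (.reg 4)) ;; .emit (.plus (.reg 6) (.lit 1))) ;;
    .emit (.plus (.reg 6) (.lit 1))) ;;
  .emit (.lit 0)

/-- Writes the routes of all agents. -/
def writeRoutes : Prog := forLoop 3 (.reg 1) writeRoute

theorem Leads.duration_le (h : I.Leads l c) (hB : ∀ u v, I.graph.Adj u v → I.weight u v ≤ B) :
    ∀ m ∈ l, m.2.2 ≤ B := by
  induction h with
  | nil => simp
  | snoc a v _ hadj _ ih =>
    intro m hm
    rcases List.mem_append.1 hm with hm | hm
    · exact ih m hm
    · obtain rfl := List.mem_singleton.1 hm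
      exact hB _ _ hadj

theorem Moved.frame (h : Moved F s l c) {p : Prog} {s' : State} (hf : Frame p s s')
    (hp : p.wreg 9 = false) (ha : ∀ a, p.warr a = false) : Moved F s' l c :=
  h.congr (hf.reg 9 hp) (funext fun a => hf.arr a (ha a))

/-- The log is replayed once per agent, and the loop invariant is that the output is the route
induced by the moves read so far. The inner loop runs as long as a move lasts, so the weights enter
the time bound here. -/
theorem runs_writeRoute (hs : Loaded I s) (h : Moved F s l c)
    (hB : ∀ u v, I.graph.Adj u v → I.weight u v ≤ B) (hB' : I.n * I.n ≤ B) {i : Fin I.k}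
    (h3 : s.reg 3 = i) :
    Runs B writeRoute s fun s' => s'.out = s.out ++ I.encodeRoute (routeOf l i) := by
  have hst := hs.start i
  refine Runs.seq (R := fun s' => s'.reg 6 = I.start i)
    (.straight rfl (by simp [Prog.run, Expr.eval, h3, hst])) fun s₁ hf₁ h6 => ?_
  have o₁ : s₁.out = s.out := hf₁.out rfl
  refine Runs.seq (R := fun s' => s'.out = s.out ++ [(I.start i : ℕ) + 1])
    (.straight rfl (by simp [Prog.run, Expr.eval, h6, o₁])) fun s₂ hf₂ o₂ => ?_
  replace h6 : s₂.reg 6 = I.start i := (hf₂.reg 6 rfl).trans h6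
  have hm₂ := (h.frame hf₁ rfl fun _ => rfl).frame hf₂ rfl fun _ => rfl
  have h3₂ : s₂.reg 3 = i := ((hf₂.reg 3 rfl).trans (hf₁.reg 3 rfl)).trans h3
  refine Runs.seq (R := fun s' => s'.out = s.out ++ (routeOf l i).nodes) ?_ fun s₃ _ o₃ =>
    .straight rfl (by simp [Prog.run, Expr.eval, o₃, encodeRoute, Route.nodes])
  refine Runs.forLoop l.length (fun j s' => s'.reg 6 = (routeOf (l.take j) i).last ∧
    s'.out = s.out ++ (routeOf (l.take j) i).nodes) rfl ?_
    (fun s' hf => (hf.reg 9 rfl).trans hm₂.length) ?_ ?_ ?_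
  · have := hm₂.potential
    lia
  · simp [State.setReg, routeOf, h6, o₂]
  · rintro j s₃ hj hf₃ h4 ⟨h6₃, o₃⟩
    have hm₃ := hm₂.frame hf₃ rfl fun _ => rfl
    have h3₃ : s₃.reg 3 = i := (hf₃.reg 3 rfl).trans h3₂
    obtain ⟨h11, h12, h13⟩ := hm₃.log j hj
    have htake : routeOf (l.take (j + 1)) i = stepRoute i (routeOf (l.take j) i) l[j] := by
      rw [List.take_add_one, List.getElem?_eq_getElem hj, Option.toList_some, routeOf,
        List.foldl_append, List.foldl_cons, List.foldl_nil, routeOf]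
    set ρ := routeOf (l.take j) i with hρ
    -- Both branches leave the last node of the step unwritten: it is the extra unit of waiting,
    -- emitted by the common final instruction.
    refine Runs.seq (R := fun s' => s'.reg 6 = (stepRoute i ρ l[j]).last ∧
      s'.out ++ [((stepRoute i ρ l[j]).last : ℕ) + 1] = s.out ++ (stepRoute i ρ l[j]).nodes) ?_ ?_
    · refine Runs.ite (fun hne => ?_) fun heq => ?_
      · rw [Ne, neExpr_eval] at hne
        simp only [Expr.eval, h4, h11, h3₃, add_left_inj, Fin.val_inj] at hne
        simp only [stepRoute, if_neg hne]
        refine Runs.forLoop l[j].2.2 (fun t s' => s'.reg 6 = ρ.last ∧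
          s'.out = s.out ++ (ρ.stay t).nodes) rfl
          (hm₃.leads.duration_le hB _ (List.getElem_mem hj)) (fun s' hf => ?_) ?_ ?_ ?_
        · simp only [Expr.eval, hf.reg 4 rfl, hf.arr 13 rfl, h4, h13]
        · exact ⟨h6₃, o₃⟩
        · rintro t s₄ - - - ⟨h6₄, o₄⟩
          refine .straight rfl ⟨h6₄, ?_⟩
          simp [State.setReg, Prog.run, Expr.eval, h6₄, o₄, Route.stay]
        · rintro s' - ⟨h6₄, o₄⟩
          refine ⟨by simpa using h6₄, ?_⟩
          rw [o₄, Route.stay, Route.nodes_snoc, Route.last_snoc, List.append_assoc]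
      · rw [neExpr_eval] at heq
        simp only [Expr.eval, h4, h11, h3₃, add_left_inj, Fin.val_inj] at heq
        refine .straight rfl ?_
        simp [stepRoute, if_pos heq, Prog.run, Expr.eval, h4, h12, o₃]
    · rintro s₄ - ⟨h6₄, o₄⟩
      refine .straight rfl ?_
      rw [htake]
      refine ⟨h6₄, ?_⟩
      rw [← o₄]
      simp [State.setReg, Prog.run, Expr.eval, h6₄]
  · rintro s' - ⟨-, o⟩
    rwa [List.take_length] at o

theorem runs_writeRoutes (hs : Loaded I s) (h : Moved F s l c)
    (hB : ∀ u v, I.graph.Adj u v → I.weight u v ≤ B) (hB' : I.n * I.n ≤ B) (hk : I.k ≤ B) :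
    Runs B writeRoutes s fun s' => s'.out = s.out ++
      (List.finRange I.k).flatMap fun i => I.encodeRoute (routeOf l i) := by
  refine Runs.forLoop I.k (fun j s' => s'.out = s.out ++
    ((List.finRange I.k).take j).flatMap fun i => I.encodeRoute (routeOf l i)) rfl hk
    (fun s' hf => (hf.reg 1 rfl).trans hs.k) ?_ ?_ ?_
  · simp [State.setReg]
  · intro j s₁ hj hf h3 hinv
    refine (runs_writeRoute (hs.frame hf rfl) (h.frame hf rfl fun _ => rfl) hB hB'
      (i := ⟨j, hj⟩) h3).mono fun s' _ h' => ?_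
    have hj' : j < (List.finRange I.k).length := by simpa using hj
    rw [List.take_add_one, List.getElem?_eq_getElem hj', List.flatMap_append, ← List.append_assoc,
      ← hinv]
    simpa [State.setReg] using h'
  · intro s' _ h'
    rwa [List.take_of_length_le (by simp)] at h'

/-! ### The solver -/

/-- The program that solves all instances. -/
def solver : Prog :=
  rows ;; growForest ;; placeTokens ;; sumSubtrees ;; checkRoots ;;
  .ite (.reg 8) (.emit (.lit 0)) (makeMoves ;; .emit (.lit 1) ;; writeRoutes)

theorem flow_eq_of_sums
    (h9 : ∀ x : Fin I.n, s.arr 9 x = indicator I.start x + ∑ y ∈ F.children x, s.arr 9 y)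
    (h10 : ∀ x : Fin I.n, s.arr 10 x = indicator I.goal x + ∑ y ∈ F.children x, s.arr 10 y)
    (x : Fin I.n) :
    flow I s x = ((indicator I.start x : ℤ) - indicator I.goal x) +
      ∑ y ∈ F.children x, flow I s y := by
  simp only [flow]
  rw [Finset.sum_sub_distrib]
  have h₁ := h9 x
  have h₂ := h10 x
  zify at h₁ h₂
  lia

theorem moved_nil (h8 : Occupancy I.start (s.arr 8)) (hm : s.reg 9 = 0)
    (h9 : ∀ x : Fin I.n, s.arr 9 x = indicator I.start x + ∑ y ∈ F.children x, s.arr 9 y)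
    (h10 : ∀ x : Fin I.n, s.arr 10 x = indicator I.goal x + ∑ y ∈ F.children x, s.arr 10 y)
    (hroot : ∀ x : Fin I.n, F.par x = x → s.arr 9 x = s.arr 10 x) :
    Moved F s [] I.start := by
  refine ⟨.nil, h8, hm, by simp, flow_eq_of_sums h9 h10, fun x hx => ?_, ?_⟩
  · rw [flow, hroot x hx, sub_self]
  -- Both subtree counts lie between 0 and `n`, so their difference is at most `n` in absolute
  -- value; there are `n` nodes.
  · have hle : ∀ x : Fin I.n, (flow I s x).natAbs ≤ I.n := by
      intro x
      have h₁ := F.subtreeSum_le_card (a := fun x => s.arr 9 x) h9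
        (fun x => by rw [indicator]; split_ifs <;> lia) x
      have h₂ := F.subtreeSum_le_card (a := fun x => s.arr 10 x) h10
        (fun x => by rw [indicator]; split_ifs <;> lia) x
      rw [Fintype.card_fin] at h₁ h₂
      rw [flow]
      lia
    simpa using Finset.sum_le_sum fun (x : Fin I.n) (_ : x ∈ Finset.univ) => hle x

theorem runs_solver (hn : I.n ≤ B) (hk : I.k ≤ B) (hsq : I.n * I.n + 1 ≤ B)
    (hw : ∀ u v, I.graph.Adj u v → I.weight u v ≤ B) :
    Runs B solver I.input fun s' => ∃ answer : Option (Fin I.k → Route I.n),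
      s'.out = I.encodeAnswer answer ∧ I.IsCorrectAnswer answer := by
  refine Runs.seq (runs_rows hn) fun s₁ f₁ hs₁ => ?_
  have zero : ∀ {a}, rows.warr a = false → 4 ≤ a → ∀ x, s₁.arr a x = 0 := by
    intro a ha h4 x
    rw [f₁.arr a ha]
    match a, h4 with
    | a + 4, _ => rfl
  refine Runs.seq (runs_growForest hs₁ hn (zero rfl (by lia))) fun s₂ f₂ ⟨F, hF₂⟩ => ?_
  have hs₂ := hs₁.frame f₂ rfl
  refine Runs.seq (runs_placeTokens hs₂ hk (fun x => ?_) (fun x => ?_) fun x => ?_)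
    fun s₃ f₃ ⟨h8, h9, h10⟩ => ?_
  · rw [f₂.arr 8 rfl, zero rfl (by lia)]
  · rw [f₂.arr 9 rfl, zero rfl (by lia)]
  · rw [f₂.arr 10 rfl, zero rfl (by lia)]
  have hs₃ := hs₂.frame f₃ rfl
  have hF₃ : StoresForest F s₃ := ⟨by rw [f₃.arr 6 rfl]; exact hF₂.par,
    by rw [f₃.arr 7 rfl]; exact hF₂.ord⟩
  refine Runs.seq (runs_sumSubtrees hs₃ hn hF₃ h9 h10) fun s₄ f₄ ⟨h9, h10⟩ => ?_
  have hs₄ := hs₃.frame f₄ rfl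
  have hF₄ : StoresForest F s₄ := ⟨by rw [f₄.arr 6 rfl]; exact hF₃.par,
    by rw [f₄.arr 7 rfl]; exact hF₃.ord⟩
  refine Runs.seq (runs_checkRoots hs₄ hn hF₄) fun s₅ f₅ hr => ?_
  have hs₅ := hs₄.frame f₅ rfl
  have hF₅ : StoresForest F s₅ := ⟨by rw [f₅.arr 6 rfl]; exact hF₄.par,
    by rw [f₅.arr 7 rfl]; exact hF₄.ord⟩
  have out₅ : s₅.out = [] := by
    rw [f₅.out rfl, f₄.out rfl, f₃.out rfl, f₂.out rfl, f₁.out rfl]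
    rfl
  refine Runs.ite (fun hbad => .straight rfl ⟨none, ?_, ?_⟩) fun hgood => ?_
  · simp [Prog.run, Expr.eval, out₅, encodeAnswer]
  · rintro ⟨π, hπ⟩
    refine hbad (hr.2 fun x hx => ?_)
    -- A hypothetical routing balances every closed set, so all roots would have passed the test.
    have := F.root_eq_zero (flow_eq_of_sums h9 h10)
      (fun U hU => by simpa [indicator] using hπ.sum_eq_zero hU) x hx
    rw [flow] at this
    lia
  · have hm : Moved F s₅ [] I.start := by
      refine moved_nil ?_ ?_ ?_ ?_ ?_
      · rw [f₅.arr 8 rfl, f₄.arr 8 rfl]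
        exact h8
      · rw [f₅.reg 9 rfl, f₄.reg 9 rfl, f₃.reg 9 rfl, f₂.reg 9 rfl, f₁.reg 9 rfl]
        rfl
      · rw [f₅.arr 9 rfl]
        exact h9
      · rw [f₅.arr 10 rfl]
        exact h10
      · rw [f₅.arr 9 rfl, f₅.arr 10 rfl]
        exact hr.1 hgood
    refine Runs.seq (runs_makeMoves hs₅ hn hsq hF₅ hm) fun s₆ f₆ ⟨l, c, hm₆, hc⟩ => ?_
    have out₆ : s₆.out = [] := by rw [f₆.out rfl, out₅]
    refine Runs.seq (R := fun s' => s'.out = [1])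
      (.straight rfl (by simp [Prog.run, Expr.eval, out₆])) fun s₇ f₇ out₇ => ?_
    refine (runs_writeRoutes ((hs₅.frame f₆ rfl).frame f₇ rfl)
      (hm₆.frame f₇ rfl fun _ => rfl) hw (by lia) hk).mono fun s' _ h' => ?_
    exact ⟨some (routeOf l), by rw [h', out₇]; rfl, hm₆.leads.isCorrectAnswer hc⟩

end AMAPF

theorem mainTheorem1 :
    ∃ solver : RAM.Prog, ∀ p : Polynomial ℕ, ∃ q : Polynomial ℕ, ∀ I : AMAPF,
      (∀ u v, I.graph.Adj u v → I.weight u v ≤ p.eval (I.n + I.k)) →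
      ∃ (t : ℕ) (final : RAM.State) (answer : Option (Fin I.k → Route I.n)),
        RAM.Exec solver I.input t final ∧
        t ≤ q.eval (I.n + I.k) ∧
        final.out = I.encodeAnswer answer ∧
        I.IsCorrectAnswer answer := by
  obtain ⟨P, hP⟩ := AMAPF.solver.exists_time_eq_eval
  -- With `X` standing for `n + k`, the inner polynomial exceeds every loop bound: `n`, `k`, `n * n
  -- + 1` and the weights. The solver itself does not depend on `p`.
  refine ⟨AMAPF.solver, fun p => ⟨P.comp (.X + .X * .X + 1 + p), fun I hw => ?_⟩⟩
  have hB : (Polynomial.X + Polynomial.X * Polynomial.X + 1 + p).eval (I.n + I.k) =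
      (I.n + I.k) + (I.n + I.k) * (I.n + I.k) + 1 + p.eval (I.n + I.k) := by simp
  have hsq : I.n * I.n ≤ (I.n + I.k) * (I.n + I.k) :=
    Nat.mul_le_mul (Nat.le_add_right _ _) (Nat.le_add_right _ _)
  obtain ⟨t, final, hexec, ht, answer, hout, hans⟩ := AMAPF.runs_solver (I := I)
    (B := (Polynomial.X + Polynomial.X * Polynomial.X + 1 + p).eval (I.n + I.k))
    (by rw [hB]; lia) (by rw [hB]; lia) (by rw [hB]; lia)
    (fun u v huv => (hw u v huv).trans (by rw [hB]; lia))
  exact ⟨t, final, answer, hexec, by rwa [Polynomial.eval_comp, ← hP], hout, hans⟩
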